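/- Let $n>2$. Write $M_n$ for the monoid of monotone maps $\{0<\dots<n-1\}\to\{0<\dots<n-1\}$, ordered pointwise; for $0\le k\le n-2$ let $T_k\in M_n$ send $k$ to $k+1$ and fix all other elements, and let $G_k\in M_n$ send $k+1$ to $k$ and fix all other elements (so $G_k\le \mathrm{id}\le T_k$). A *symmetric monoidal $n$-comprehension with recursion* is a symmetric monoidal category $(\mathcal C,\otimes,\top,l,a,\sigma)$ together with 1. a strict action of $M_n$: every $\varphi\in M_n$ acts as a strict symmetric monoidal endofunctor of $\mathcal C$, every inequality $\varphi\le\psi$ acts as a monoidal natural transformation, the identity acts as the identity, the composite $\varphi\circ\psi$ acts as the endofunctor of $\psi$ after that of $\varphi$, and vertical and horizontal composites of inequalities are respected (the endofunctors given by $T_k,G_k$ are again denoted $T_k,G_k$, and $\eta_k:\mathrm{id}\Rightarrow T_k$, $\epsilon_k:G_k\Rightarrow\mathrm{id}$ are the transformations given by $\mathrm{id}\le T_k$ and $G_k\le\mathrm{id}$); 2. an object $N_0$ and morphisms $\top\xrightarrow{0_0}N_0\xrightarrow{s_0}N_0$; one puts $N_{i+1}=G_iN_i$, $0_{i+1}=G_i0_i$,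 $s_{i+1}=G_is_i$ for $0\le i\le n-2$, and requires that $T_iN_j$ is $\top$ if $i=j=0$, $N_{i-1}$ if $i=j\ne0$ and $N_j$ otherwise, that $G_iN_j$ is $N_{i+1}$ if $i=j$ and $N_j$ otherwise, and that $T_00_0=T_0s_0=1_\top$; 3. flat recursion: for all $g:X\to Y$ and $h:N_0\otimes X\to Y$ with $X,Y$ tensor powers of $N_0$ there is a unique $f:N_0\otimes X\to Y$ with $f\circ(0_0\otimes X)=g\circ l$ and $f\circ(s_0\otimes X)=h$; 4. safe ramified recursion: for all $0\le k\le n-2$, $g:X\to Y$ and $h:Y\to Y$ such that $Y$ becomes isomorphic to $\top$ after applying $T_k$, then $T_{k-1}$, ..., then $T_0$, there is a unique $f:N_{k+1}\otimes X\to Y$ with $f\circ(0_{k+1}\otimes X)=g\circ l$ and $f\circ(s_{k+1}\otimes X)=h\circ f$; 5. safe dependent recursion: for all $0\le k\le n-2$, all $X,Y$ that are tensor products of levels $N_i$ with $Y$ as in 4, and all $g:X\to Y$ and $h:(N_{k+1}\otimes X)\otimes Y\to Y$, there is a unique $f:N_{k+1}\otimes X\to Y$ with $f\circ(0_{k+1}\otimes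 X)=g\circ l$ and $f\circ(s_{k+1}\otimes X)=h\circ(\mathrm{id}\otimes f)\circ\delta$, where $\delta$ is the diagonal of $N_{k+1}\otimes X$. Diagonals of tensor products of levels are built with the symmetry from the diagonals of the levels: if $d_k:N_{k+1}\to N_k\otimes N_k$ is the morphism that 4 gives for $0_k\otimes 0_k$ and $s_k\otimes s_k$, then $\delta_{N_{k+1}}=G_kd_k$ and $\delta_{N_0}=T_1\delta_{N_1}$. Let $\mathcal{FR}^n$ be the free such structure: its objects are the tensor expressions in $\top,N_0,\dots,N_{n-1}$, and its morphisms are the formal morphism terms generated by the operations above, modulo the equations above. Let $\Gamma=\mathcal{FR}^n(\top,-)$ be its global sections functor. **Corollary.** For every $k=0,\dots,n-1$ the map $\mathrm{std}_k:\mathbf N\to\Gamma N_k$ given by $\mathrm{std}_k(0)=0_k$ and $\mathrm{std}_k(m+1)=s_k\circ\mathrm{std}_k(m)$ is a bijection. Hence $\Gamma N_k$, with the zero $0_k$ and the successor $\Gamma s_k$, is a copy of the natural numbers $\mathbf N$. -/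

import Mathlib

/-!
# The free symmetric monoidal n-comprehension with recursion

The category is presented by generators and relations: objects are tensor expressions in the unit
and the levels `N 0, ..., N (n-1)`; morphisms are formal terms modulo the least congruence that
contains the laws of a symmetric monoidal category, of a strict action of the monoid of monotone
maps of `{0 < ... < n-1}` together with its order, of the initial diagram, and of the three
recursion schemes (each of them with existence and uniqueness). Only derivably well typed terms
are morphisms.
-/

open CategoryTheory MonoidalCategory

namespace FreeRec

/-- The objects: tensor expressions in the unit `⊤` and the levels `N 0, ..., N (n-1)`. -/
inductive FR (n : ℕ) : Type
  | unit : FR n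
  | N (j : Fin n) : FR n
  | tensor (X Y : FR n) : FR n

variable {n : ℕ}

/-! ### The coercion endofunctors of the ordinal `n` -/

/-- `T k` sends `k` to `k + 1` and fixes every other element. -/
def T (k : ℕ) (hk : k + 1 < n) : Fin n →o Fin n where
  toFun j := if j.1 = k then ⟨k + 1, hk⟩ else j
  monotone' := by
    intro a b hab
    have hab' : a.1 ≤ b.1 := hab
    simp only [Fin.le_def]
    split_ifs <;> simp <;> omega

/-- `G k` sends `k + 1` to `k` and fixes every other element. -/
def G (k : ℕ) (hk : k + 1 < n) : Fin n →o Fin n where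
  toFun j := if j.1 = k + 1 then ⟨k, by omega⟩ else j
  monotone' := by
    intro a b hab
    have hab' : a.1 ≤ b.1 := hab
    simp only [Fin.le_def]
    split_ifs <;> simp <;> omega

theorem T_val (k : ℕ) (hk : k + 1 < n) (j : Fin n) :
    (T k hk j).1 = if j.1 = k then k + 1 else j.1 := by
  show (if j.1 = k then (⟨k + 1, hk⟩ : Fin n) else j).1 = _
  split_ifs <;> rfl

theorem G_val (k : ℕ) (hk : k + 1 < n) (j : Fin n) :
    (G k hk j).1 = if j.1 = k + 1 then k else j.1 := by
  show (if j.1 = k + 1 then (⟨k, by omega⟩ : Fin n) else j).1 = _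
  split_ifs <;> rfl

namespace FR

/-- The action of a monotone map `φ` on a level. The level `N j` is thought of as a chain which is
a copy of the naturals in the positions `0, ..., j` and trivial afterwards, and `φ` acts by
precomposition: the result is `N m` for the largest `m` with `φ m ≤ j`, and the unit if there is no
such `m`. For `T k` and `G k` this is the table proved in `act_T_N` and `act_G_N` below. -/
def actN (φ : Fin n →o Fin n) (j : Fin n) : FR n :=
  if h : (Finset.univ.filter fun i => φ i ≤ j).Nonempty then N (Finset.max' _ h) else unit

/-- The action of a monotone map on objects; it is strictly monoidal. -/
def act (φ : Fin n →o Fin n) : FR n → FR n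
  | unit => unit
  | N j => actN φ j
  | tensor X Y => tensor (act φ X) (act φ Y)

theorem actN_eq_N {φ : Fin n →o Fin n} {j m : Fin n} (h1 : φ m ≤ j)
    (h2 : ∀ i, φ i ≤ j → i ≤ m) : actN φ j = N m := by
  have hne : (Finset.univ.filter fun i => φ i ≤ j).Nonempty := ⟨m, by simpa using h1⟩
  unfold actN
  rw [dif_pos hne]
  congr 1
  apply le_antisymm
  · exact Finset.max'_le _ _ _ (fun i hi => h2 i (by simpa using hi))
  · exact Finset.le_max' _ _ (by simpa using h1)

theorem actN_eq_unit {φ : Fin n →o Fin n} {j : Fin n} (h : ∀ i, j < φ i) :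
    actN φ j = unit := by
  unfold actN
  rw [dif_neg]
  rintro ⟨i, hi⟩
  exact absurd (by simpa using hi) (not_le.mpr (h i))

/-- `T_k N_j` is `⊤` if `k = j = 0`, it is `N_(k-1)` if `k = j ≠ 0`, and `N_j` otherwise. -/
theorem act_T_N (k : ℕ) (hk : k + 1 < n) (j : Fin n) :
    (N j).act (T k hk) =
      if j.1 = k then (if k = 0 then unit else N ⟨k - 1, by omega⟩) else N j := by
  show actN (T k hk) j = _
  split_ifs with h1 h2
  · apply actN_eq_unit
    intro i
    rw [Fin.lt_def, T_val]
    split_ifs <;> omega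
  · apply actN_eq_N
    · rw [Fin.le_def, T_val]
      dsimp only
      split_ifs <;> omega
    · intro i
      rw [Fin.le_def, T_val, Fin.le_def]
      dsimp only
      split_ifs <;> omega
  · apply actN_eq_N
    · rw [Fin.le_def, T_val]
      split_ifs <;> omega
    · intro i
      rw [Fin.le_def, T_val, Fin.le_def]
      split_ifs <;> omega

/-- `G_k N_j` is `N_(k+1)` if `k = j`, and `N_j` otherwise. -/
theorem act_G_N (k : ℕ) (hk : k + 1 < n) (j : Fin n) :
    (N j).act (G k hk) = if j.1 = k then N ⟨k + 1, hk⟩ else N j := by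
  show actN (G k hk) j = _
  split_ifs with h1
  · apply actN_eq_N
    · rw [Fin.le_def, G_val]
      dsimp only
      split_ifs <;> omega
    · intro i
      rw [Fin.le_def, G_val, Fin.le_def]
      dsimp only
      split_ifs <;> omega
  · apply actN_eq_N
    · rw [Fin.le_def, G_val]
      split_ifs <;> omega
    · intro i
      rw [Fin.le_def, G_val, Fin.le_def]
      split_ifs <;> omega

/-- `T_0 (T_1 (... (T_k Y)))`: this erases exactly the levels `0, ..., k`. -/
def low : (k : ℕ) → k + 1 < n → FR n → FR n
  | 0, hk, Y => Y.act (T 0 hk)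
  | k + 1, hk, Y => low k (by omega) (Y.act (T (k + 1) hk))

/-- The objects `N_0^α`: tensor powers of `N 0` (up to bracketing and units). -/
inductive IsPowZero : FR n → Prop
  | unit : IsPowZero unit
  | base (h : 0 < n) : IsPowZero (N ⟨0, h⟩)
  | tensor {X Y : FR n} : IsPowZero X → IsPowZero Y → IsPowZero (tensor X Y)

end FR

open FR

/-! ### Terms -/

/-- Formal morphism terms, with enough annotations to determine source and target. -/
inductive Tm (n : ℕ) : Type
  /-- identity of `X` -/
  | ident (X : FR n) : Tm n
  /-- first `f`, then `g`, through the object `Y` -/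
  | comp (Y : FR n) (f g : Tm n) : Tm n
  /-- tensor product of two morphisms -/
  | tens (f g : Tm n) : Tm n
  /-- left unitor `l : ⊤ ⊗ X → X` -/
  | lun (X : FR n) : Tm n
  | lunInv (X : FR n) : Tm n
  /-- associator `a : (X ⊗ Y) ⊗ Z → X ⊗ (Y ⊗ Z)` -/
  | asc (X Y Z : FR n) : Tm n
  | ascInv (X Y Z : FR n) : Tm n
  /-- symmetry `σ : X ⊗ Y → Y ⊗ X` -/
  | sym (X Y : FR n) : Tm n
  /-- the endofunctor attached to a monotone map, applied to a morphism -/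
  | act (φ : Fin n →o Fin n) (f : Tm n) : Tm n
  /-- the component at `X` of the transformation attached to `φ ≤ ψ` -/
  | cell (φ ψ : Fin n →o Fin n) (X : FR n) : Tm n
  /-- `0_0 : ⊤ → N_0` -/
  | zero : Tm n
  /-- `s_0 : N_0 → N_0` -/
  | succ : Tm n
  /-- flat recursion `FR(g, h)` -/
  | flat (g h : Tm n) : Tm n
  /-- safe ramified recursion `SRR_k(g, h)` -/
  | srr (k : ℕ) (g h : Tm n) : Tm n
  /-- safe dependent recursion `SDR_k(g, h)` -/
  | sdr (k : ℕ) (g h : Tm n) : Tm n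

namespace Tm

/-- Right unitor `r : X ⊗ ⊤ → X`, that is `σ` followed by `l`. -/
def run (X : FR n) : Tm n := comp (tensor unit X) (sym X unit) (lun X)

def runInv (X : FR n) : Tm n := comp (tensor unit X) (lunInv X) (sym unit X)

/-- `0_0`, and `0_(j+1) = G_j 0_j`. -/
def zeroN : (j : ℕ) → j < n → Tm n
  | 0, _ => zero
  | j + 1, h => act (G j h) (zeroN j (by omega))

/-- `s_0`, and `s_(j+1) = G_j s_j`. -/
def succN : (j : ℕ) → j < n → Tm n
  | 0, _ => succ
  | j + 1, h => act (G j h) (succN j (by omega))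

/-- The morphism `N_(k+1) → N_k ⊗ N_k` defined by `SRR_k` from `0_k ⊗ 0_k` and `s_k ⊗ s_k`. -/
def dup (k : ℕ) (hk : k + 1 < n) : Tm n :=
  comp (tensor (N ⟨k + 1, hk⟩) unit) (runInv (N ⟨k + 1, hk⟩))
    (srr k
      (comp (tensor unit unit) (lunInv unit) (tens (zeroN k (by omega)) (zeroN k (by omega))))
      (tens (succN k (by omega)) (succN k (by omega))))

/-- The diagonal `N_j → N_j ⊗ N_j`: apply `G_k` to `dup k` if `j = k + 1`, and lower the diagonal
of `N_1` with `T_1` if `j = 0`. -/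
def deltaN (hn : 2 < n) : (j : ℕ) → j < n → Tm n
  | 0, _ => act (T 1 (by omega)) (act (G 0 (by omega)) (dup 0 (by omega)))
  | k + 1, hk => act (G k hk) (dup k hk)

/-- `(X ⊗ X) ⊗ (Y ⊗ Y) → (X ⊗ Y) ⊗ (X ⊗ Y)`, the exchange of the two middle factors. -/
def mid (X Y : FR n) : Tm n :=
  comp (tensor X (tensor X (tensor Y Y))) (asc X X (tensor Y Y)) <|
  comp (tensor X (tensor Y (tensor X Y)))
    (tens (ident X) <|
      comp (tensor (tensor X Y) Y) (ascInv X Y Y) <|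
      comp (tensor (tensor Y X) Y) (tens (sym X Y) (ident Y)) (asc Y X Y))
    (ascInv X Y (tensor X Y))

/-- The diagonal `X → X ⊗ X` of an arbitrary object. -/
def delta (hn : 2 < n) : FR n → Tm n
  | .unit => lunInv unit
  | .N j => deltaN hn j.1 j.2
  | .tensor X Y =>
      comp (tensor (tensor X X) (tensor Y Y)) (tens (delta hn X) (delta hn Y)) (mid X Y)

end Tm

open Tm

/-! ### Equality of morphisms -/

/-- `Eqv f g X Y`: the terms `f` and `g` are well typed morphisms `X → Y` and they are equal as
such. In particular `Eqv f f X Y` says that `f` is a morphism `X → Y`. -/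
inductive Eqv : Tm n → Tm n → FR n → FR n → Prop
  | symm {f g X Y} : Eqv f g X Y → Eqv g f X Y
  | trans {f g h X Y} : Eqv f g X Y → Eqv g h X Y → Eqv f h X Y
  -- category
  | ident (X) : Eqv (ident X) (ident X) X X
  | comp {f f' g g' X Y Z} : Eqv f f' X Y → Eqv g g' Y Z →
      Eqv (comp Y f g) (comp Y f' g') X Z
  | id_comp {f X Y} : Eqv f f X Y → Eqv (Tm.comp X (Tm.ident X) f) f X Y
  | comp_id {f X Y} : Eqv f f X Y → Eqv (Tm.comp Y f (Tm.ident Y)) f X Y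
  | assoc {f g h X Y Z W} : Eqv f f X Y → Eqv g g Y Z → Eqv h h Z W →
      Eqv (Tm.comp Z (Tm.comp Y f g) h) (Tm.comp Y f (Tm.comp Z g h)) X W
  -- tensor product
  | tens {f f' g g' X Y Z W} : Eqv f f' X Y → Eqv g g' Z W →
      Eqv (tens f g) (tens f' g') (tensor X Z) (tensor Y W)
  | tens_id (X Y) : Eqv (Tm.tens (Tm.ident X) (Tm.ident Y)) (Tm.ident (tensor X Y))
      (tensor X Y) (tensor X Y)
  | tens_comp {f f' g g' X Y Z X' Y' Z'} :
      Eqv f f X Y → Eqv g g Y Z → Eqv f' f' X' Y' → Eqv g' g' Y' Z' →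
      Eqv (Tm.tens (Tm.comp Y f g) (Tm.comp Y' f' g'))
        (Tm.comp (tensor Y Y') (Tm.tens f f') (Tm.tens g g')) (tensor X X') (tensor Z Z')
  -- unitor, associator, symmetry
  | lun (X) : Eqv (lun X) (lun X) (tensor unit X) X
  | lunInv (X) : Eqv (lunInv X) (lunInv X) X (tensor unit X)
  | lun_lunInv (X) : Eqv (Tm.comp X (Tm.lun X) (Tm.lunInv X)) (Tm.ident (tensor unit X))
      (tensor unit X) (tensor unit X)
  | lunInv_lun (X) : Eqv (Tm.comp (tensor unit X) (Tm.lunInv X) (Tm.lun X)) (Tm.ident X) X X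
  | asc (X Y Z) : Eqv (asc X Y Z) (asc X Y Z)
      (tensor (tensor X Y) Z) (tensor X (tensor Y Z))
  | ascInv (X Y Z) : Eqv (ascInv X Y Z) (ascInv X Y Z)
      (tensor X (tensor Y Z)) (tensor (tensor X Y) Z)
  | asc_ascInv (X Y Z) : Eqv (Tm.comp (tensor X (tensor Y Z)) (Tm.asc X Y Z) (Tm.ascInv X Y Z))
      (Tm.ident (tensor (tensor X Y) Z)) (tensor (tensor X Y) Z) (tensor (tensor X Y) Z)
  | ascInv_asc (X Y Z) : Eqv (Tm.comp (tensor (tensor X Y) Z) (Tm.ascInv X Y Z) (Tm.asc X Y Z))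
      (Tm.ident (tensor X (tensor Y Z))) (tensor X (tensor Y Z)) (tensor X (tensor Y Z))
  | sym (X Y) : Eqv (sym X Y) (sym X Y) (tensor X Y) (tensor Y X)
  | sym_sym (X Y) : Eqv (Tm.comp (tensor Y X) (Tm.sym X Y) (Tm.sym Y X))
      (Tm.ident (tensor X Y)) (tensor X Y) (tensor X Y)
  | lun_nat {f X Y} : Eqv f f X Y →
      Eqv (Tm.comp (tensor unit Y) (Tm.tens (Tm.ident unit) f) (Tm.lun Y))
        (Tm.comp X (Tm.lun X) f) (tensor unit X) Y
  | asc_nat {f g h X Y Z X' Y' Z'} : Eqv f f X X' → Eqv g g Y Y' → Eqv h h Z Z' →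
      Eqv (Tm.comp (tensor (tensor X' Y') Z') (Tm.tens (Tm.tens f g) h) (Tm.asc X' Y' Z'))
        (Tm.comp (tensor X (tensor Y Z)) (Tm.asc X Y Z) (Tm.tens f (Tm.tens g h)))
        (tensor (tensor X Y) Z) (tensor X' (tensor Y' Z'))
  | sym_nat {f g X Y X' Y'} : Eqv f f X X' → Eqv g g Y Y' →
      Eqv (Tm.comp (tensor X' Y') (Tm.tens f g) (Tm.sym X' Y'))
        (Tm.comp (tensor Y X) (Tm.sym X Y) (Tm.tens g f)) (tensor X Y) (tensor Y' X')
  | pentagon (W X Y Z) :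
      Eqv (Tm.comp (tensor (tensor W (tensor X Y)) Z) (Tm.tens (Tm.asc W X Y) (Tm.ident Z))
          (Tm.comp (tensor W (tensor (tensor X Y) Z)) (Tm.asc W (tensor X Y) Z)
            (Tm.tens (Tm.ident W) (Tm.asc X Y Z))))
        (Tm.comp (tensor (tensor W X) (tensor Y Z)) (Tm.asc (tensor W X) Y Z)
          (Tm.asc W X (tensor Y Z)))
        (tensor (tensor (tensor W X) Y) Z) (tensor W (tensor X (tensor Y Z)))
  | triangle (X Y) :
      Eqv (Tm.comp (tensor X (tensor unit Y)) (Tm.asc X unit Y) (Tm.tens (Tm.ident X) (Tm.lun Y)))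
        (Tm.tens (run X) (Tm.ident Y)) (tensor (tensor X unit) Y) (tensor X Y)
  | hexagon (X Y Z) :
      Eqv (Tm.comp (tensor X (tensor Y Z)) (Tm.asc X Y Z)
          (Tm.comp (tensor (tensor Y Z) X) (Tm.sym X (tensor Y Z)) (Tm.asc Y Z X)))
        (Tm.comp (tensor (tensor Y X) Z) (Tm.tens (Tm.sym X Y) (Tm.ident Z))
          (Tm.comp (tensor Y (tensor X Z)) (Tm.asc Y X Z) (Tm.tens (Tm.ident Y) (Tm.sym X Z))))
        (tensor (tensor X Y) Z) (tensor Y (tensor Z X))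
  -- every monotone map acts as a strict symmetric monoidal functor
  | act (φ) {f f' X Y} : Eqv f f' X Y → Eqv (act φ f) (act φ f') (X.act φ) (Y.act φ)
  | act_ident (φ X) : Eqv (Tm.act φ (Tm.ident X)) (Tm.ident (X.act φ)) (X.act φ) (X.act φ)
  | act_comp (φ) {f g X Y Z} : Eqv f f X Y → Eqv g g Y Z →
      Eqv (Tm.act φ (Tm.comp Y f g)) (Tm.comp (Y.act φ) (Tm.act φ f) (Tm.act φ g))
        (X.act φ) (Z.act φ)
  | act_tens (φ) {f g X Y Z W} : Eqv f f X Y → Eqv g g Z W →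
      Eqv (Tm.act φ (Tm.tens f g)) (Tm.tens (Tm.act φ f) (Tm.act φ g))
        ((tensor X Z).act φ) ((tensor Y W).act φ)
  | act_lun (φ X) : Eqv (Tm.act φ (Tm.lun X)) (Tm.lun (X.act φ))
      ((tensor unit X).act φ) (X.act φ)
  | act_asc (φ X Y Z) : Eqv (Tm.act φ (Tm.asc X Y Z)) (Tm.asc (X.act φ) (Y.act φ) (Z.act φ))
      ((tensor (tensor X Y) Z).act φ) ((tensor X (tensor Y Z)).act φ)
  | act_sym (φ X Y) : Eqv (Tm.act φ (Tm.sym X Y)) (Tm.sym (X.act φ) (Y.act φ))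
      ((tensor X Y).act φ) ((tensor Y X).act φ)
  -- the assignment is contravariantly functorial for composition of monotone maps
  | act_id {f X Y} : Eqv f f X Y → Eqv (Tm.act OrderHom.id f) f X Y
  | act_act (φ ψ) {f X Y} : Eqv f f X Y →
      Eqv (Tm.act ψ (Tm.act φ f)) (Tm.act (φ.comp ψ) f) ((X.act φ).act ψ) ((Y.act φ).act ψ)
  -- inequalities of monotone maps act as monoidal natural transformations, compatibly with
  -- vertical composition and with whiskering on both sides
  | cell {φ ψ} (hle : φ ≤ ψ) (X) : Eqv (cell φ ψ X) (cell φ ψ X) (X.act φ) (X.act ψ)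
  | cell_nat {φ ψ} (hle : φ ≤ ψ) {f X Y} : Eqv f f X Y →
      Eqv (Tm.comp (Y.act φ) (Tm.act φ f) (Tm.cell φ ψ Y))
        (Tm.comp (X.act ψ) (Tm.cell φ ψ X) (Tm.act ψ f)) (X.act φ) (Y.act ψ)
  | cell_refl (φ X) : Eqv (Tm.cell φ φ X) (Tm.ident (X.act φ)) (X.act φ) (X.act φ)
  | cell_trans {φ ψ χ} (h1 : φ ≤ ψ) (h2 : ψ ≤ χ) (X) :
      Eqv (Tm.comp (X.act ψ) (Tm.cell φ ψ X) (Tm.cell ψ χ X)) (Tm.cell φ χ X)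
        (X.act φ) (X.act χ)
  | act_cell (θ) {φ ψ} (hle : φ ≤ ψ) (X) :
      Eqv (Tm.act θ (Tm.cell φ ψ X)) (Tm.cell (φ.comp θ) (ψ.comp θ) X)
        ((X.act φ).act θ) ((X.act ψ).act θ)
  | cell_act (θ) {φ ψ} (hle : φ ≤ ψ) (X) :
      Eqv (Tm.cell φ ψ (X.act θ)) (Tm.cell (θ.comp φ) (θ.comp ψ) X)
        ((X.act θ).act φ) ((X.act θ).act ψ)
  | cell_unit {φ ψ} (hle : φ ≤ ψ) : Eqv (Tm.cell φ ψ unit) (Tm.ident unit) unit unit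
  | cell_tensor {φ ψ} (hle : φ ≤ ψ) (X Y) :
      Eqv (Tm.cell φ ψ (tensor X Y)) (Tm.tens (Tm.cell φ ψ X) (Tm.cell φ ψ Y))
        ((tensor X Y).act φ) ((tensor X Y).act ψ)
  -- the initial diagram; `T_0` collapses it
  | zero (h : 0 < n) : Eqv zero zero unit (N ⟨0, h⟩)
  | succ (h : 0 < n) : Eqv succ succ (N ⟨0, h⟩) (N ⟨0, h⟩)
  | T_zero (h : 0 + 1 < n) : Eqv (Tm.act (T 0 h) Tm.zero) (Tm.ident unit) unit unit
  | T_succ (h : 0 + 1 < n) : Eqv (Tm.act (T 0 h) Tm.succ) (Tm.ident unit) unit unit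
  -- flat recursion: congruence, the two triangles, uniqueness
  | flat (h0 : 0 < n) {X Y g g' h h'} : X.IsPowZero → Y.IsPowZero →
      Eqv g g' X Y → Eqv h h' (tensor (N ⟨0, h0⟩) X) Y →
      Eqv (flat g h) (flat g' h') (tensor (N ⟨0, h0⟩) X) Y
  | flat_zero (h0 : 0 < n) {X Y g h} : X.IsPowZero → Y.IsPowZero →
      Eqv g g X Y → Eqv h h (tensor (N ⟨0, h0⟩) X) Y →
      Eqv (Tm.comp (tensor (N ⟨0, h0⟩) X) (Tm.tens Tm.zero (Tm.ident X)) (Tm.flat g h))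
        (Tm.comp X (Tm.lun X) g) (tensor unit X) Y
  | flat_succ (h0 : 0 < n) {X Y g h} : X.IsPowZero → Y.IsPowZero →
      Eqv g g X Y → Eqv h h (tensor (N ⟨0, h0⟩) X) Y →
      Eqv (Tm.comp (tensor (N ⟨0, h0⟩) X) (Tm.tens Tm.succ (Tm.ident X)) (Tm.flat g h))
        h (tensor (N ⟨0, h0⟩) X) Y
  | flat_uniq (h0 : 0 < n) {X Y g h f} : X.IsPowZero → Y.IsPowZero →
      Eqv g g X Y → Eqv h h (tensor (N ⟨0, h0⟩) X) Y → Eqv f f (tensor (N ⟨0, h0⟩) X) Y →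
      Eqv (Tm.comp (tensor (N ⟨0, h0⟩) X) (Tm.tens Tm.zero (Tm.ident X)) f)
        (Tm.comp X (Tm.lun X) g) (tensor unit X) Y →
      Eqv (Tm.comp (tensor (N ⟨0, h0⟩) X) (Tm.tens Tm.succ (Tm.ident X)) f)
        h (tensor (N ⟨0, h0⟩) X) Y →
      Eqv f (Tm.flat g h) (tensor (N ⟨0, h0⟩) X) Y
  -- safe ramified recursion; `i` and `j` are mutually inverse morphisms between
  -- `low k Y` and the unit
  | srr {k} (hk : k + 1 < n) {X Y g g' h h' i j} :
      Eqv i i (low k hk Y) unit → Eqv j j unit (low k hk Y) →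
      Eqv (Tm.comp unit i j) (Tm.ident (low k hk Y)) (low k hk Y) (low k hk Y) →
      Eqv (Tm.comp (low k hk Y) j i) (Tm.ident unit) unit unit →
      Eqv g g' X Y → Eqv h h' Y Y →
      Eqv (srr k g h) (srr k g' h') (tensor (N ⟨k + 1, hk⟩) X) Y
  | srr_zero {k} (hk : k + 1 < n) {X Y g h i j} :
      Eqv i i (low k hk Y) unit → Eqv j j unit (low k hk Y) →
      Eqv (Tm.comp unit i j) (Tm.ident (low k hk Y)) (low k hk Y) (low k hk Y) →
      Eqv (Tm.comp (low k hk Y) j i) (Tm.ident unit) unit unit →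
      Eqv g g X Y → Eqv h h Y Y →
      Eqv (Tm.comp (tensor (N ⟨k + 1, hk⟩) X) (Tm.tens (zeroN (k + 1) hk) (Tm.ident X))
          (Tm.srr k g h))
        (Tm.comp X (Tm.lun X) g) (tensor unit X) Y
  | srr_succ {k} (hk : k + 1 < n) {X Y g h i j} :
      Eqv i i (low k hk Y) unit → Eqv j j unit (low k hk Y) →
      Eqv (Tm.comp unit i j) (Tm.ident (low k hk Y)) (low k hk Y) (low k hk Y) →
      Eqv (Tm.comp (low k hk Y) j i) (Tm.ident unit) unit unit →
      Eqv g g X Y → Eqv h h Y Y →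
      Eqv (Tm.comp (tensor (N ⟨k + 1, hk⟩) X) (Tm.tens (succN (k + 1) hk) (Tm.ident X))
          (Tm.srr k g h))
        (Tm.comp Y (Tm.srr k g h) h) (tensor (N ⟨k + 1, hk⟩) X) Y
  | srr_uniq {k} (hk : k + 1 < n) {X Y g h i j f} :
      Eqv i i (low k hk Y) unit → Eqv j j unit (low k hk Y) →
      Eqv (Tm.comp unit i j) (Tm.ident (low k hk Y)) (low k hk Y) (low k hk Y) →
      Eqv (Tm.comp (low k hk Y) j i) (Tm.ident unit) unit unit →
      Eqv g g X Y → Eqv h h Y Y → Eqv f f (tensor (N ⟨k + 1, hk⟩) X) Y →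
      Eqv (Tm.comp (tensor (N ⟨k + 1, hk⟩) X) (Tm.tens (zeroN (k + 1) hk) (Tm.ident X)) f)
        (Tm.comp X (Tm.lun X) g) (tensor unit X) Y →
      Eqv (Tm.comp (tensor (N ⟨k + 1, hk⟩) X) (Tm.tens (succN (k + 1) hk) (Tm.ident X)) f)
        (Tm.comp Y f h) (tensor (N ⟨k + 1, hk⟩) X) Y →
      Eqv f (Tm.srr k g h) (tensor (N ⟨k + 1, hk⟩) X) Y
  -- safe dependent recursion; the pairing of the identity with `f` is the diagonal followed by
  -- the tensor product of the identity and `f`; every object is a tensor product of levels, so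
  -- that `X` and `Y` are arbitrary
  | sdr (hn : 2 < n) {k} (hk : k + 1 < n) {X Y g g' h h' i j} :
      Eqv i i (low k hk Y) unit → Eqv j j unit (low k hk Y) →
      Eqv (Tm.comp unit i j) (Tm.ident (low k hk Y)) (low k hk Y) (low k hk Y) →
      Eqv (Tm.comp (low k hk Y) j i) (Tm.ident unit) unit unit →
      Eqv g g' X Y → Eqv h h' (tensor (tensor (N ⟨k + 1, hk⟩) X) Y) Y →
      Eqv (sdr k g h) (sdr k g' h') (tensor (N ⟨k + 1, hk⟩) X) Y
  | sdr_zero (hn : 2 < n) {k} (hk : k + 1 < n) {X Y g h i j} :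
      Eqv i i (low k hk Y) unit → Eqv j j unit (low k hk Y) →
      Eqv (Tm.comp unit i j) (Tm.ident (low k hk Y)) (low k hk Y) (low k hk Y) →
      Eqv (Tm.comp (low k hk Y) j i) (Tm.ident unit) unit unit →
      Eqv g g X Y → Eqv h h (tensor (tensor (N ⟨k + 1, hk⟩) X) Y) Y →
      Eqv (Tm.comp (tensor (N ⟨k + 1, hk⟩) X) (Tm.tens (zeroN (k + 1) hk) (Tm.ident X))
          (Tm.sdr k g h))
        (Tm.comp X (Tm.lun X) g) (tensor unit X) Y
  | sdr_succ (hn : 2 < n) {k} (hk : k + 1 < n) {X Y g h i j} :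
      Eqv i i (low k hk Y) unit → Eqv j j unit (low k hk Y) →
      Eqv (Tm.comp unit i j) (Tm.ident (low k hk Y)) (low k hk Y) (low k hk Y) →
      Eqv (Tm.comp (low k hk Y) j i) (Tm.ident unit) unit unit →
      Eqv g g X Y → Eqv h h (tensor (tensor (N ⟨k + 1, hk⟩) X) Y) Y →
      Eqv (Tm.comp (tensor (N ⟨k + 1, hk⟩) X) (Tm.tens (succN (k + 1) hk) (Tm.ident X))
          (Tm.sdr k g h))
        (Tm.comp (tensor (tensor (N ⟨k + 1, hk⟩) X) (tensor (N ⟨k + 1, hk⟩) X))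
          (delta hn (tensor (N ⟨k + 1, hk⟩) X))
          (Tm.comp (tensor (tensor (N ⟨k + 1, hk⟩) X) Y)
            (Tm.tens (Tm.ident (tensor (N ⟨k + 1, hk⟩) X)) (Tm.sdr k g h)) h))
        (tensor (N ⟨k + 1, hk⟩) X) Y
  | sdr_uniq (hn : 2 < n) {k} (hk : k + 1 < n) {X Y g h i j f} :
      Eqv i i (low k hk Y) unit → Eqv j j unit (low k hk Y) →
      Eqv (Tm.comp unit i j) (Tm.ident (low k hk Y)) (low k hk Y) (low k hk Y) →
      Eqv (Tm.comp (low k hk Y) j i) (Tm.ident unit) unit unit →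
      Eqv g g X Y → Eqv h h (tensor (tensor (N ⟨k + 1, hk⟩) X) Y) Y →
      Eqv f f (tensor (N ⟨k + 1, hk⟩) X) Y →
      Eqv (Tm.comp (tensor (N ⟨k + 1, hk⟩) X) (Tm.tens (zeroN (k + 1) hk) (Tm.ident X)) f)
        (Tm.comp X (Tm.lun X) g) (tensor unit X) Y →
      Eqv (Tm.comp (tensor (N ⟨k + 1, hk⟩) X) (Tm.tens (succN (k + 1) hk) (Tm.ident X)) f)
        (Tm.comp (tensor (tensor (N ⟨k + 1, hk⟩) X) (tensor (N ⟨k + 1, hk⟩) X))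
          (delta hn (tensor (N ⟨k + 1, hk⟩) X))
          (Tm.comp (tensor (tensor (N ⟨k + 1, hk⟩) X) Y)
            (Tm.tens (Tm.ident (tensor (N ⟨k + 1, hk⟩) X)) f) h))
        (tensor (N ⟨k + 1, hk⟩) X) Y →
      Eqv f (Tm.sdr k g h) (tensor (N ⟨k + 1, hk⟩) X) Y

theorem Eqv.zeroN : ∀ (j : ℕ) (hj : j < n), Eqv (zeroN j hj) (zeroN j hj) unit (N ⟨j, hj⟩)
  | 0, hj => Eqv.zero hj
  | j + 1, hj => by
      have h := Eqv.act (FreeRec.G j hj) (Eqv.zeroN j (by omega))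
      rw [act_G_N, if_pos rfl] at h
      exact h

theorem Eqv.succN : ∀ (j : ℕ) (hj : j < n),
    Eqv (succN j hj) (succN j hj) (N ⟨j, hj⟩) (N ⟨j, hj⟩)
  | 0, hj => Eqv.succ hj
  | j + 1, hj => by
      have h := Eqv.act (FreeRec.G j hj) (Eqv.succN j (by omega))
      rw [act_G_N, if_pos rfl] at h
      exact h

/-! ### The category -/

/-- Well typed terms `X → Y`. -/
def WT (X Y : FR n) : Type := {f : Tm n // Eqv f f X Y}

instance wtSetoid (X Y : FR n) : Setoid (WT X Y) where
  r f g := Eqv f.1 g.1 X Y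
  iseqv := ⟨fun f => f.2, fun h => h.symm, fun h h' => h.trans h'⟩

/-- Morphisms: well typed terms modulo derivable equality. -/
def Mor (X Y : FR n) : Type := Quotient (wtSetoid X Y)

/-- The morphism denoted by a well typed term. -/
def mk {X Y : FR n} (f : Tm n) (hf : Eqv f f X Y) : Mor X Y := Quotient.mk _ ⟨f, hf⟩

instance : CategoryStruct (FR n) where
  Hom X Y := Mor X Y
  id X := mk (Tm.ident X) (Eqv.ident X)
  comp {_ Y _} f g :=
    Quotient.map₂ (fun f g => ⟨Tm.comp Y f.1 g.1, Eqv.comp f.2 g.2⟩)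
      (fun _ _ h _ _ h' => Eqv.comp h h') f g

instance : Category (FR n) where
  id_comp f := Quotient.inductionOn f fun f => Quotient.sound (Eqv.id_comp f.2)
  comp_id f := Quotient.inductionOn f fun f => Quotient.sound (Eqv.comp_id f.2)
  assoc f g h := Quotient.inductionOn₃ f g h fun f g h =>
    Quotient.sound (Eqv.assoc f.2 g.2 h.2)

/-- Tensor product of morphisms. -/
def tensMor {X Y Z W : FR n} (f : X ⟶ Y) (g : Z ⟶ W) : tensor X Z ⟶ tensor Y W :=
  Quotient.map₂ (fun f g => ⟨Tm.tens f.1 g.1, Eqv.tens f.2 g.2⟩)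
    (fun _ _ h _ _ h' => Eqv.tens h h') f g

theorem Eqv.run (X : FR n) : Eqv (run X) (run X) (tensor X unit) X :=
  Eqv.comp (Eqv.sym _ _) (Eqv.lun _)

theorem Eqv.runInv (X : FR n) : Eqv (runInv X) (runInv X) X (tensor X unit) :=
  Eqv.comp (Eqv.lunInv _) (Eqv.sym _ _)

def lunIso (X : FR n) : tensor unit X ≅ X where
  hom := mk (Tm.lun X) (Eqv.lun X)
  inv := mk (Tm.lunInv X) (Eqv.lunInv X)
  hom_inv_id := Quotient.sound (Eqv.lun_lunInv X)
  inv_hom_id := Quotient.sound (Eqv.lunInv_lun X)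

def symIso (X Y : FR n) : tensor X Y ≅ tensor Y X where
  hom := mk (Tm.sym X Y) (Eqv.sym X Y)
  inv := mk (Tm.sym Y X) (Eqv.sym Y X)
  hom_inv_id := Quotient.sound (Eqv.sym_sym X Y)
  inv_hom_id := Quotient.sound (Eqv.sym_sym Y X)

def ascIso (X Y Z : FR n) : tensor (tensor X Y) Z ≅ tensor X (tensor Y Z) where
  hom := mk (Tm.asc X Y Z) (Eqv.asc X Y Z)
  inv := mk (Tm.ascInv X Y Z) (Eqv.ascInv X Y Z)
  hom_inv_id := Quotient.sound (Eqv.asc_ascInv X Y Z)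
  inv_hom_id := Quotient.sound (Eqv.ascInv_asc X Y Z)

theorem tensMor_id (X Y : FR n) : tensMor (𝟙 X) (𝟙 Y) = 𝟙 (tensor X Y) :=
  Quotient.sound (Eqv.tens_id X Y)

theorem tensMor_comp {X Y Z X' Y' Z' : FR n} (f : X ⟶ Y) (f' : X' ⟶ Y') (g : Y ⟶ Z)
    (g' : Y' ⟶ Z') : tensMor f f' ≫ tensMor g g' = tensMor (f ≫ g) (f' ≫ g') := by
  induction f using Quotient.inductionOn with | _ f
  induction f' using Quotient.inductionOn with | _ f'
  induction g using Quotient.inductionOn with | _ g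
  induction g' using Quotient.inductionOn with | _ g'
  exact Quotient.sound (Eqv.tens_comp f.2 g.2 f'.2 g'.2).symm

theorem lunIso_nat {X Y : FR n} (f : X ⟶ Y) :
    tensMor (𝟙 unit) f ≫ (lunIso Y).hom = (lunIso X).hom ≫ f := by
  induction f using Quotient.inductionOn with | _ f
  exact Quotient.sound (Eqv.lun_nat f.2)

theorem symIso_nat {X Y X' Y' : FR n} (f : X ⟶ X') (g : Y ⟶ Y') :
    tensMor f g ≫ (symIso X' Y').hom = (symIso X Y).hom ≫ tensMor g f := by
  induction f using Quotient.inductionOn with | _ f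
  induction g using Quotient.inductionOn with | _ g
  exact Quotient.sound (Eqv.sym_nat f.2 g.2)

theorem ascIso_nat {X Y Z X' Y' Z' : FR n} (f : X ⟶ X') (g : Y ⟶ Y') (h : Z ⟶ Z') :
    tensMor (tensMor f g) h ≫ (ascIso X' Y' Z').hom =
      (ascIso X Y Z).hom ≫ tensMor f (tensMor g h) := by
  induction f using Quotient.inductionOn with | _ f
  induction g using Quotient.inductionOn with | _ g
  induction h using Quotient.inductionOn with | _ h
  exact Quotient.sound (Eqv.asc_nat f.2 g.2 h.2)

instance : MonoidalCategoryStruct (FR n) where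
  tensorObj := tensor
  tensorUnit := unit
  tensorHom := tensMor
  whiskerLeft X _ _ f := tensMor (𝟙 X) f
  whiskerRight f Y := tensMor f (𝟙 Y)
  associator := ascIso
  leftUnitor := lunIso
  rightUnitor X := symIso X unit ≪≫ lunIso X

instance : MonoidalCategory (FR n) :=
  MonoidalCategory.ofTensorHom
    (id_tensorHom_id := tensMor_id)
    (id_tensorHom := fun _ _ _ _ => rfl)
    (tensorHom_id := fun _ _ => rfl)
    (tensorHom_comp_tensorHom := tensMor_comp)
    (associator_naturality := ascIso_nat)
    (leftUnitor_naturality := lunIso_nat)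
    (rightUnitor_naturality := fun {X Y} f => by
      show tensMor f (𝟙 unit) ≫ (symIso Y unit).hom ≫ (lunIso Y).hom =
        ((symIso X unit).hom ≫ (lunIso X).hom) ≫ f
      rw [← Category.assoc, symIso_nat, Category.assoc, lunIso_nat, Category.assoc])
    (pentagon := fun W X Y Z => Quotient.sound (Eqv.pentagon W X Y Z))
    (triangle := fun X Y => Quotient.sound (Eqv.triangle X Y))

theorem symIso_hexagon (X Y Z : FR n) :
    (α_ X Y Z).hom ≫ (symIso X (Y ⊗ Z)).hom ≫ (α_ Y Z X).hom =
      ((symIso X Y).hom ▷ Z) ≫ (α_ Y X Z).hom ≫ (Y ◁ (symIso X Z).hom) :=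
  Quotient.sound (Eqv.hexagon X Y Z)

instance : BraidedCategory (FR n) where
  braiding := symIso
  braiding_naturality_right X _ _ f := symIso_nat (𝟙 X) f
  braiding_naturality_left f Z := symIso_nat f (𝟙 Z)
  hexagon_forward := symIso_hexagon
  hexagon_reverse X Y Z := by
    have h := congrArg (fun e : ((Z ⊗ X) ⊗ Y ≅ X ⊗ (Y ⊗ Z)) => e.inv)
      (Iso.ext (symIso_hexagon Z X Y) :
        (α_ Z X Y) ≪≫ symIso Z (X ⊗ Y) ≪≫ (α_ X Y Z) =
          whiskerRightIso (symIso Z X) Y ≪≫ (α_ X Z Y) ≪≫ whiskerLeftIso X (symIso Z Y))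
    simp only [Iso.trans_inv, whiskerRightIso_inv, whiskerLeftIso_inv, Category.assoc] at h
    exact h

instance : SymmetricCategory (FR n) where
  symmetry X Y := Quotient.sound (Eqv.sym_sym X Y)

/-- The action of a monotone map on morphisms. -/
def actMor (φ : Fin n →o Fin n) {X Y : FR n} (f : X ⟶ Y) : X.act φ ⟶ Y.act φ :=
  Quotient.map (fun f => ⟨Tm.act φ f.1, Eqv.act φ f.2⟩) (fun _ _ h => Eqv.act φ h) f

/-- The endofunctor attached to a monotone map. -/
def coerce (φ : Fin n →o Fin n) : FR n ⥤ FR n where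
  obj X := X.act φ
  map f := actMor φ f
  map_id X := Quotient.sound (Eqv.act_ident φ X)
  map_comp {X Y Z} f g := by
    induction f using Quotient.inductionOn with | _ f
    induction g using Quotient.inductionOn with | _ g
    exact Quotient.sound (Eqv.act_comp φ f.2 g.2)

/-- The natural transformation attached to `φ ≤ ψ`; `η_k` and `ε_k` are the cases
`id ≤ T k` and `G k ≤ id`. -/
def coerceLE {φ ψ : Fin n →o Fin n} (hle : φ ≤ ψ) : coerce φ ⟶ coerce ψ where
  app X := (mk (Tm.cell φ ψ X) (Eqv.cell hle X) : X.act φ ⟶ X.act ψ)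
  naturality X Y f := by
    induction f using Quotient.inductionOn with | _ f
    exact Quotient.sound (Eqv.cell_nat hle f.2)

/-- The zero `0_k : ⊤ → N_k`. -/
def zeroMor (k : Fin n) : 𝟙_ (FR n) ⟶ N k := mk (zeroN k.1 k.2) (Eqv.zeroN k.1 k.2)

/-- The successor `s_k : N_k → N_k`. -/
def succMor (k : Fin n) : N k ⟶ N k := mk (succN k.1 k.2) (Eqv.succN k.1 k.2)

/-- The global sections functor `Γ X = Hom(⊤, X)`, `Γ f = f ∘ -`. -/
def Gam (n : ℕ) : FR n ⥤ Type := coyoneda.obj (Opposite.op (𝟙_ (FR n)))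

/-- The standard numerals: `std_k 0 = 0_k` and `std_k (m + 1) = s_k ∘ std_k m`. -/
def std (k : Fin n) : ℕ → (𝟙_ (FR n) ⟶ N k)
  | 0 => zeroMor k
  | m + 1 => std k m ≫ succMor k

end FreeRec

/-! The term model is compared with a standard model built over the chain `0 < ... < n-1`. The level
`N j` becomes the functor on this chain that is ℕ at the stages `0, ..., j` and a point afterwards;
a monotone map acts by precomposition, and an inequality `φ ≤ ψ` acts by the transition maps from
stage `φ i` to stage `ψ i`. The recursion schemes hold there because the target degenerates no later
than the counter does: powers of `N 0` are points beyond stage `0`, and a safe target for recursion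
over `N (k+1)` is a point beyond stage `k`. At stage `0` the interpretation of the `m`-th numeral is
`m`, so distinct numerals are not derivably equal.

Surjectivity needs a converse: a term computes, inside the term model, what its interpretation
predicts. This is a computability (gluing) argument. At a later stage a value no longer determines a
numeral, so the prediction can be required only up to the stage, namely after acting with the
constant map `cst i`. That notion suits the coercions because `φ ∘ cst i = cst (φ i)`. After acting
with `cst i`, the `m`-th numerals of all levels `j ≥ i` coincide, and all numerals of a level `j <
i` become the identity of the unit (`act_stdTm_of_le`, `act_stdTm_of_lt`, hence `act_elem` and
`act_elem_tr`).

`Good` combines the two halves, and `Eqv.sound` proves it by one induction on derivations. At stage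
`0` nothing is lost: `cst 0 ≤ id`, and the corresponding transformation is the identity on the unit,
so naturality recovers a global element from its restriction (`Eqv.of_act_cst_zero`). Hence each `f
: ⊤ → N k` equals the numeral that its interpretation at stage `0` names. -/

namespace FreeRec

open FR

variable {n : ℕ}

/-! ### The standard model

An object is interpreted, at each stage `i : Fin n`, as a set of untyped values, and a term as a
function on values. -/

/-- Untyped values. -/
inductive Val : Type
  | star : Val
  | nat (m : ℕ) : Val
  | pair (a b : Val) : Val

namespace Val

/-- The default `0` matters: at a stage where a level is a point, its value `star` counts as zero,
so a recursion over it stops at the base case. -/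
def toNat : Val → ℕ
  | nat m => m
  | _ => 0

def fst : Val → Val
  | pair a _ => a
  | v => v

def snd : Val → Val
  | pair _ b => b
  | v => v

@[simp] theorem toNat_nat (m : ℕ) : (nat m).toNat = m := rfl
@[simp] theorem toNat_star : star.toNat = 0 := rfl
@[simp] theorem fst_pair (a b : Val) : (pair a b).fst = a := rfl
@[simp] theorem snd_pair (a b : Val) : (pair a b).snd = b := rfl

end Val

open Val

/-- `Mem X i v`: the value `v` belongs to the interpretation of `X` at stage `i`. -/
def Mem : FR n → Fin n → Val → Prop
  | unit, _, v => v = star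
  | N j, i, v => if i ≤ j then ∃ m, v = nat m else v = star
  | .tensor X Y, i, v => ∃ a b, v = pair a b ∧ Mem X i a ∧ Mem Y i b

/-- The transition map of `X` from an arbitrary earlier stage to the stage `i`. -/
def tr : FR n → Fin n → Val → Val
  | unit, _, _ => star
  | N j, i, v => if i ≤ j then v else star
  | .tensor X Y, i, v => pair (tr X i v.fst) (tr Y i v.snd)

/-- The interpretation of a term at a stage. -/
def ev : Tm n → Fin n → Val → Val
  | .ident _, _, v => v
  | .comp _ f g, i, v => ev g i (ev f i v)
  | .tens f g, i, v => pair (ev f i v.fst) (ev g i v.snd)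
  | .lun _, _, v => v.snd
  | .lunInv _, _, v => pair star v
  | .asc _ _ _, _, v => pair v.fst.fst (pair v.fst.snd v.snd)
  | .ascInv _ _ _, _, v => pair (pair v.fst v.snd.fst) v.snd.snd
  | .sym _ _, _, v => pair v.snd v.fst
  -- Precomposition: stage `i` of the reindexed functor is stage `φ i` of the original one.
  | .act φ f, i, v => ev f (φ i) v
  | .cell _ ψ X, i, v => tr X (ψ i) v
  | .zero, i, _ => if i.1 = 0 then nat 0 else star
  | .succ, i, v => if i.1 = 0 then nat (v.toNat + 1) else star
  | .flat g h, i, v =>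
      Nat.casesOn v.fst.toNat (ev g i v.snd) fun m => ev h i (pair (nat m) v.snd)
  | .srr _ g h, i, v => Nat.rec (ev g i v.snd) (fun _ y => ev h i y) v.fst.toNat
  | .sdr _ g h, i, v =>
      Nat.rec (ev g i v.snd) (fun m y => ev h i (pair (pair (nat m) v.snd) y)) v.fst.toNat

theorem mem_N_of_le {j i : Fin n} (h : i ≤ j) (v : Val) : Mem (N j) i v ↔ ∃ m, v = nat m := by
  simp [Mem, h]

theorem mem_N_of_lt {j i : Fin n} (h : j < i) (v : Val) : Mem (N j) i v ↔ v = star := by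
  simp [Mem, h]

/-- By monotonicity the stages that `φ` sends to `j` or below form an initial segment, which is
empty or has a greatest element. This is why precomposition with `φ` turns a level into a level or
the unit. -/
theorem actN_cases (φ : Fin n →o Fin n) (j : Fin n) :
    (∃ m, actN φ j = N m ∧ ∀ i, i ≤ m ↔ φ i ≤ j) ∨ (actN φ j = unit ∧ ∀ i, ¬ φ i ≤ j) := by
  by_cases h : (Finset.univ.filter fun i => φ i ≤ j).Nonempty
  · refine Or.inl ⟨Finset.max' _ h, ?_, fun i => ⟨fun hi => ?_, fun hi => ?_⟩⟩
    · unfold actN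
      rw [dif_pos h]
    · have hm := Finset.max'_mem _ h
      simp only [Finset.mem_filter, Finset.mem_univ, true_and] at hm
      exact (φ.monotone hi).trans hm
    · exact Finset.le_max' _ _ (by simpa using hi)
  · have h' : ∀ i, ¬ φ i ≤ j := fun i hi => h ⟨i, by simpa using hi⟩
    exact Or.inr ⟨actN_eq_unit fun i => not_le.mp (h' i), h'⟩

theorem mem_act (φ : Fin n →o Fin n) (X : FR n) (i : Fin n) (v : Val) :
    Mem (X.act φ) i v ↔ Mem X (φ i) v := by
  induction X generalizing v with
  | unit => rfl
  | N j =>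
    change Mem (actN φ j) i v ↔ _
    rcases actN_cases φ j with ⟨m, hm, h⟩ | ⟨hm, h⟩ <;> simp [hm, Mem, h]
  | tensor X Y hX hY => simp only [FR.act, Mem, hX, hY]

theorem tr_act (φ : Fin n →o Fin n) (X : FR n) (i : Fin n) (v : Val) :
    tr (X.act φ) i v = tr X (φ i) v := by
  induction X generalizing v with
  | unit => rfl
  | N j =>
    change tr (actN φ j) i v = _
    rcases actN_cases φ j with ⟨m, hm, h⟩ | ⟨hm, h⟩ <;> simp [hm, tr, h]
  | tensor X Y hX hY => simp only [FR.act, tr, hX, hY]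

theorem tr_self {X : FR n} {i : Fin n} {v : Val} (h : Mem X i v) : tr X i v = v := by
  induction X generalizing v with
  | unit => exact Eq.symm h
  | N j =>
    rcases le_or_gt i j with hi | hi
    · simp [tr, hi]
    · rw [mem_N_of_lt hi] at h
      simp [tr, not_le.mpr hi, h]
  | tensor X Y hX hY =>
    obtain ⟨a, b, rfl, ha, hb⟩ := h
    simp [tr, hX ha, hY hb]

theorem mem_tr {X : FR n} {i i' : Fin n} {v : Val} (hi : i ≤ i') (h : Mem X i v) :
    Mem X i' (tr X i' v) := by
  induction X generalizing v with
  | unit => rfl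
  | N j =>
    rcases le_or_gt i' j with hj | hj
    · rw [mem_N_of_le (hi.trans hj)] at h
      simpa [tr, hj, mem_N_of_le hj] using h
    · simp [tr, not_le.mpr hj, mem_N_of_lt hj]
  | tensor X Y hX hY =>
    obtain ⟨a, b, rfl, ha, hb⟩ := h
    exact ⟨_, _, rfl, hX ha, hY hb⟩

theorem tr_tr (X : FR n) {i i' : Fin n} (h : i ≤ i') (v : Val) :
    tr X i' (tr X i v) = tr X i' v := by
  induction X generalizing v with
  | unit => rfl
  | N j =>
    by_cases hj : i' ≤ j
    · simp [tr, hj, h.trans hj]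
    · simp [tr, hj]
  | tensor X Y hX hY => simp [tr, hX, hY]

/-- `X` has at most one value at stage `i`. -/
def Trivial (X : FR n) (i : Fin n) : Prop := ∀ a b, Mem X i a → Mem X i b → a = b

theorem FR.IsPowZero.trivial {X : FR n} (h : X.IsPowZero) {i : Fin n} (hi : 0 < i.1) :
    Trivial X i := by
  induction h with
  | unit => rintro a b rfl rfl; rfl
  | base h0 =>
    intro a b ha hb
    rw [mem_N_of_lt hi] at ha hb
    rw [ha, hb]
  | tensor _ _ hX hY =>
    rintro _ _ ⟨a, b, rfl, ha, hb⟩ ⟨a', b', rfl, ha', hb'⟩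
    rw [hX _ _ ha ha', hY _ _ hb hb']

/-- Each of `T 0, ..., T k` moves only one stage, and that stage is at most `k`; the later stages
are fixed by all of them. -/
theorem mem_low {k : ℕ} (hk : k + 1 < n) (X : FR n) {i : Fin n} (hi : k < i.1) (v : Val) :
    Mem (low k hk X) i v ↔ Mem X i v := by
  induction k generalizing X with
  | zero =>
    have : T 0 hk i = i := Fin.ext (by rw [T_val, if_neg (by omega)])
    rw [low, mem_act, this]
  | succ k ih =>
    have : T (k + 1) hk i = i := Fin.ext (by rw [T_val, if_neg (by omega)])
    rw [low, ih (by omega) _ (by omega), mem_act, this]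

theorem ev_zeroN (j : ℕ) (hj : j < n) (i : Fin n) (v : Val) :
    ev (Tm.zeroN j hj) i v = if i.1 ≤ j then nat 0 else star := by
  induction j generalizing i with
  | zero => simp [Tm.zeroN, ev]
  | succ j ih =>
    simp only [Tm.zeroN, ev, ih, G_val]
    congr 1
    split_ifs <;> simp <;> omega

theorem ev_succN (j : ℕ) (hj : j < n) (i : Fin n) (v : Val) :
    ev (Tm.succN j hj) i v = if i.1 ≤ j then nat (v.toNat + 1) else star := by
  induction j generalizing i with
  | zero => simp [Tm.succN, ev]
  | succ j ih =>
    simp only [Tm.succN, ev, ih, G_val]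
    congr 1
    split_ifs <;> simp <;> omega

/-! ### Canonical global elements -/

/-- The numeral `m` as a term `⊤ → N_j`. -/
def stdTm (j : Fin n) : ℕ → Tm n
  | 0 => Tm.zeroN j.1 j.2
  | m + 1 => Tm.comp (N j) (stdTm j m) (Tm.succN j.1 j.2)

/-- The pairing of two global elements. -/
def pr (a b : Tm n) : Tm n := Tm.comp (tensor unit unit) (Tm.lunInv unit) (Tm.tens a b)

/-- The global element of `X` named by a value. -/
def elem : FR n → Val → Tm n
  | unit, _ => Tm.ident unit
  | N j, v => stdTm j v.toNat
  | .tensor X Y, v => pr (elem X v.fst) (elem Y v.snd)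

theorem Eqv.left {f g : Tm n} {X Y : FR n} (h : Eqv f g X Y) : Eqv f f X Y := h.trans h.symm

theorem Eqv.right {f g : Tm n} {X Y : FR n} (h : Eqv f g X Y) : Eqv g g X Y := h.symm.trans h

theorem Eqv.stdTm (j : Fin n) (m : ℕ) : Eqv (stdTm j m) (stdTm j m) unit (N j) := by
  induction m with
  | zero => exact Eqv.zeroN _ _
  | succ m ih => exact Eqv.comp ih (Eqv.succN _ _)

theorem Eqv.pr {a a' b b' : Tm n} {X Y : FR n} (ha : Eqv a a' unit X) (hb : Eqv b b' unit Y) :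
    Eqv (pr a b) (pr a' b') unit (tensor X Y) :=
  Eqv.comp (Eqv.lunInv _) (Eqv.tens ha hb)

theorem Eqv.elem (X : FR n) (v : Val) : Eqv (elem X v) (elem X v) unit X := by
  induction X generalizing v with
  | unit => exact Eqv.ident _
  | N j => exact Eqv.stdTm _ _
  | tensor X Y hX hY => exact Eqv.pr (hX _) (hY _)

/-- An identity proved in the quotient category is a derivable equality of terms; this gives access
to the identities valid in every symmetric monoidal category. -/
theorem mk_exact {f g : Tm n} {X Y : FR n} {hf : Eqv f f X Y} {hg : Eqv g g X Y}
    (h : mk f hf = mk g hg) : Eqv f g X Y := Quotient.exact h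

/-! ### Pairs of global elements in a monoidal category -/

section Pairing

variable {C : Type*} [Category* C] [MonoidalCategory C] {X Y Z X' Y' : C}

theorem pairing_comp (a : 𝟙_ C ⟶ X) (b : 𝟙_ C ⟶ Y) (f : X ⟶ X') (g : Y ⟶ Y') :
    ((λ_ (𝟙_ C)).inv ≫ (a ⊗ₘ b)) ≫ (f ⊗ₘ g) = (λ_ (𝟙_ C)).inv ≫ ((a ≫ f) ⊗ₘ (b ≫ g)) := by
  simp

theorem pairing_lun (b : 𝟙_ C ⟶ Y) :
    ((λ_ (𝟙_ C)).inv ≫ (𝟙 (𝟙_ C) ⊗ₘ b)) ≫ (λ_ Y).hom = b := by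
  simp

theorem comp_lunInv (b : 𝟙_ C ⟶ Y) :
    b ≫ (λ_ Y).inv = (λ_ (𝟙_ C)).inv ≫ (𝟙 (𝟙_ C) ⊗ₘ b) := by
  simp

theorem pairing_asc (a : 𝟙_ C ⟶ X) (b : 𝟙_ C ⟶ Y) (c : 𝟙_ C ⟶ Z) :
    ((λ_ (𝟙_ C)).inv ≫ (((λ_ (𝟙_ C)).inv ≫ (a ⊗ₘ b)) ⊗ₘ c)) ≫ (α_ X Y Z).hom =
      (λ_ (𝟙_ C)).inv ≫ (a ⊗ₘ ((λ_ (𝟙_ C)).inv ≫ (b ⊗ₘ c))) := by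
  have h1 : ((λ_ (𝟙_ C)).inv ≫ (a ⊗ₘ b)) ⊗ₘ c =
      ((λ_ (𝟙_ C)).inv ▷ 𝟙_ C) ≫ ((a ⊗ₘ b) ⊗ₘ c) := by
    rw [← tensorHom_id, tensorHom_comp_tensorHom, Category.id_comp]
  have h2 : a ⊗ₘ ((λ_ (𝟙_ C)).inv ≫ (b ⊗ₘ c)) =
      (𝟙_ C ◁ (λ_ (𝟙_ C)).inv) ≫ (a ⊗ₘ (b ⊗ₘ c)) := by
    rw [← id_tensorHom, tensorHom_comp_tensorHom, Category.id_comp]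
  rw [h1, h2, Category.assoc, Category.assoc, associator_naturality]
  simp only [← Category.assoc]
  congr 1
  -- Naturality has moved the associator onto units only, where coherence decides the equality.
  monoidal

theorem pairing_sym [SymmetricCategory C] (a : 𝟙_ C ⟶ X) (b : 𝟙_ C ⟶ Y) :
    ((λ_ (𝟙_ C)).inv ≫ (a ⊗ₘ b)) ≫ (β_ X Y).hom = (λ_ (𝟙_ C)).inv ≫ (b ⊗ₘ a) := by
  rw [Category.assoc, BraidedCategory.braiding_naturality, ← Category.assoc]
  congr 1
  simp [unitors_inv_equal]

end Pairing

theorem Eqv.pr_tens {a b f g : Tm n} {X Y X' Y' : FR n} (ha : Eqv a a unit X)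
    (hb : Eqv b b unit Y) (hf : Eqv f f X X') (hg : Eqv g g Y Y') :
    Eqv (Tm.comp (tensor X Y) (FreeRec.pr a b) (Tm.tens f g))
      (FreeRec.pr (Tm.comp X a f) (Tm.comp Y b g)) unit (tensor X' Y') :=
  mk_exact (hf := Eqv.comp (Eqv.pr ha hb) (Eqv.tens hf hg))
    (hg := Eqv.pr (Eqv.comp ha hf) (Eqv.comp hb hg))
    (pairing_comp (C := FR n) (mk a ha) (mk b hb) (mk f hf) (mk g hg))

theorem Eqv.pr_lun {b : Tm n} {Y : FR n} (hb : Eqv b b unit Y) :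
    Eqv (Tm.comp (tensor unit Y) (FreeRec.pr (Tm.ident unit) b) (Tm.lun Y)) b unit Y :=
  mk_exact (hf := Eqv.comp (Eqv.pr (Eqv.ident _) hb) (Eqv.lun _)) (hg := hb)
    (pairing_lun (C := FR n) (mk b hb))

theorem Eqv.comp_lunInv {b : Tm n} {Y : FR n} (hb : Eqv b b unit Y) :
    Eqv (Tm.comp Y b (Tm.lunInv Y)) (FreeRec.pr (Tm.ident unit) b) unit (tensor unit Y) :=
  mk_exact (hf := Eqv.comp hb (Eqv.lunInv _)) (hg := Eqv.pr (Eqv.ident _) hb)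
    (FreeRec.comp_lunInv (C := FR n) (mk b hb))

theorem Eqv.pr_asc {a b c : Tm n} {X Y Z : FR n} (ha : Eqv a a unit X)
    (hb : Eqv b b unit Y) (hc : Eqv c c unit Z) :
    Eqv (Tm.comp (tensor (tensor X Y) Z) (FreeRec.pr (FreeRec.pr a b) c) (Tm.asc X Y Z))
      (FreeRec.pr a (FreeRec.pr b c)) unit (tensor X (tensor Y Z)) :=
  mk_exact (hf := Eqv.comp (Eqv.pr (Eqv.pr ha hb) hc) (Eqv.asc _ _ _))
    (hg := Eqv.pr ha (Eqv.pr hb hc))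
    (pairing_asc (C := FR n) (mk a ha) (mk b hb) (mk c hc))

/-- Cancellation in the rule for the associator. -/
theorem Eqv.pr_ascInv {a b c : Tm n} {X Y Z : FR n} (ha : Eqv a a unit X)
    (hb : Eqv b b unit Y) (hc : Eqv c c unit Z) :
    Eqv (Tm.comp (tensor X (tensor Y Z)) (FreeRec.pr a (FreeRec.pr b c)) (Tm.ascInv X Y Z))
      (FreeRec.pr (FreeRec.pr a b) c) unit (tensor (tensor X Y) Z) := by
  have h := Eqv.pr (Eqv.pr ha hb) hc
  exact (Eqv.comp (Eqv.pr_asc ha hb hc).symm (Eqv.ascInv _ _ _)).trans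
    ((Eqv.assoc h (Eqv.asc _ _ _) (Eqv.ascInv _ _ _)).trans
      ((Eqv.comp h (Eqv.asc_ascInv _ _ _)).trans (Eqv.comp_id h)))

theorem Eqv.pr_sym {a b : Tm n} {X Y : FR n} (ha : Eqv a a unit X) (hb : Eqv b b unit Y) :
    Eqv (Tm.comp (tensor X Y) (FreeRec.pr a b) (Tm.sym X Y)) (FreeRec.pr b a) unit
      (tensor Y X) :=
  mk_exact (hf := Eqv.comp (Eqv.pr ha hb) (Eqv.sym _ _)) (hg := Eqv.pr hb ha)
    (pairing_sym (C := FR n) (mk a ha) (mk b hb))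

/-! ### Restriction along constant maps -/

/-- The constant monotone map. -/
def cst (i : Fin n) : Fin n →o Fin n := ⟨fun _ => i, fun _ _ _ => le_rfl⟩

theorem cst_le_cst {i j : Fin n} (h : i ≤ j) : cst i ≤ cst j := fun _ => h

/-- Both sides are the top level, because the defining condition holds at every stage. -/
theorem actN_cst_of_le {i j i' j' : Fin n} (h : i ≤ j) (h' : i' ≤ j') :
    actN (cst i) j = actN (cst i') j' := by
  have e : (Finset.univ.filter fun x => cst i x ≤ j) =
      Finset.univ.filter fun x => cst i' x ≤ j' := by
    ext x
    simp only [Finset.mem_filter, Finset.mem_univ, true_and]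
    exact ⟨fun _ => h', fun _ => h⟩
  unfold actN
  simp only [e]

theorem actN_cst_of_lt {i j : Fin n} (h : j < i) : actN (cst i) j = unit :=
  actN_eq_unit fun _ => h

/-- The composite of `φ` with the constant map at `i` is the constant map at `φ i`. This is an
equality of objects, so terms can be retyped along it. -/
theorem act_cst (φ : Fin n →o Fin n) (i : Fin n) (X : FR n) :
    (X.act φ).act (cst i) = X.act (cst (φ i)) := by
  induction X with
  | unit => rfl
  | N j =>
    change (actN φ j).act (cst i) = actN (cst (φ i)) j
    rcases actN_cases φ j with ⟨m, hm, h⟩ | ⟨hm, h⟩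
    · rw [hm]
      rcases le_or_gt i m with him | him
      · exact actN_cst_of_le him ((h i).1 him)
      · have : j < φ i := not_le.mp fun hj => absurd ((h i).2 hj) (not_le.mpr him)
        rw [actN_cst_of_lt this]
        exact actN_cst_of_lt him
    · rw [hm, actN_cst_of_lt (not_le.mp (h i))]
      rfl
  | tensor X Y hX hY => simp only [FR.act, hX, hY]

theorem Eqv.cast {f g : Tm n} {X X' Y Y' : FR n} (h : Eqv f g X Y) (hX : X = X') (hY : Y = Y') :
    Eqv f g X' Y' := by
  subst hX hY
  exact h

/-- Contravariant functoriality of the action, for a constant map. -/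
theorem Eqv.act_cst (φ : Fin n →o Fin n) (i : Fin n) {f : Tm n} {X Y : FR n} (h : Eqv f f X Y) :
    Eqv (Tm.act (cst i) (Tm.act φ f)) (Tm.act (cst (φ i)) f) (X.act (cst (φ i)))
      (Y.act (cst (φ i))) :=
  (Eqv.act_act φ (cst i) h).cast (FreeRec.act_cst φ i X) (FreeRec.act_cst φ i Y)

theorem act_G_N_self (j : ℕ) (hj : j + 1 < n) :
    (N ⟨j, by omega⟩ : FR n).act (G j hj) = N ⟨j + 1, hj⟩ := by
  rw [act_G_N, if_pos rfl]

theorem G_le_iff (j : ℕ) (hj : j + 1 < n) (i : Fin n) : (G j hj i).1 ≤ j ↔ i.1 ≤ j + 1 := by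
  rw [G_val]
  split_ifs <;> omega

/-- Since `0_(j+1)` is `G j` applied to `0_j`, absorbing `G j` into the constant map replaces `i` by
`G j i`, which is again at most `j`. Repetition ends at `0_0` and stage `0`, whatever `i` and `j`
were. -/
theorem act_zeroN_of_le {j : ℕ} (hj : j < n) {i : Fin n} (hi : i.1 ≤ j) :
    Eqv (Tm.act (cst i) (Tm.zeroN j hj)) (Tm.act (cst ⟨0, i.pos⟩) Tm.zero) unit
      (actN (cst i) ⟨j, hj⟩) := by
  induction j generalizing i with
  | zero =>
    obtain rfl : i = ⟨0, hj⟩ := Fin.ext (by simpa using hi)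
    exact Eqv.act _ (Eqv.zero hj)
  | succ j ih =>
    have h := Eqv.act_cst (G j hj) i (Eqv.zeroN j (by omega))
    have h2 := h.trans (ih (by omega) ((G_le_iff j hj i).2 hi))
    exact h2.cast rfl (actN_cst_of_le ((G_le_iff j hj i).2 hi) hi)

theorem act_succN_of_le {j : ℕ} (hj : j < n) {i : Fin n} (hi : i.1 ≤ j) :
    Eqv (Tm.act (cst i) (Tm.succN j hj)) (Tm.act (cst ⟨0, i.pos⟩) Tm.succ)
      (actN (cst i) ⟨j, hj⟩) (actN (cst i) ⟨j, hj⟩) := by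
  induction j generalizing i with
  | zero =>
    obtain rfl : i = ⟨0, hj⟩ := Fin.ext (by simpa using hi)
    exact Eqv.act _ (Eqv.succ hj)
  | succ j ih =>
    have h := Eqv.act_cst (G j hj) i (Eqv.succN j (by omega))
    have h2 := h.trans (ih (by omega) ((G_le_iff j hj i).2 hi))
    have e := actN_cst_of_le (i := G j hj i) (j := ⟨j, by omega⟩) (j' := ⟨j + 1, hj⟩)
      ((G_le_iff j hj i).2 hi) hi
    exact h2.cast e e

theorem T_zero_of_pos {i : Fin n} (hi : 0 < i.1) (h : 0 + 1 < n) : T 0 h i = i :=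
  Fin.ext (by rw [T_val, if_neg (by omega)])

theorem act_T_N_zero (h : 0 + 1 < n) : (N ⟨0, by omega⟩ : FR n).act (T 0 h) = unit := by
  rw [act_T_N, if_pos rfl, if_pos rfl]

/-- For `j = 0`, the map `T 0` fixes the stage `i > 0`, so it may be inserted under `cst i`, and it
collapses `0_0`. For larger `j`, the map `G` fixes `i` and is dropped. -/
theorem act_zeroN_of_lt {j : ℕ} (hj : j < n) {i : Fin n} (hi : j < i.1) :
    Eqv (Tm.act (cst i) (Tm.zeroN j hj)) (Tm.ident unit) unit unit := by
  induction j generalizing i with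
  | zero =>
    have h1 : 0 + 1 < n := by omega
    have h := (Eqv.act_cst (T 0 h1) i (Eqv.zero hj)).symm
    rw [T_zero_of_pos hi] at h
    have e : (N ⟨0, hj⟩ : FR n).act (cst i) = unit := actN_cst_of_lt hi
    exact (h.cast rfl e).trans ((Eqv.act (cst i) (Eqv.T_zero h1)).trans (Eqv.act_ident _ _))
  | succ j ih =>
    have hG : G j hj i = i := Fin.ext (by rw [G_val, if_neg (by omega)])
    have h := Eqv.act_cst (G j hj) i (Eqv.zeroN j (by omega))
    rw [hG] at h
    have e : (N ⟨j, by omega⟩ : FR n).act (cst i) = unit :=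
      actN_cst_of_lt (show j < i.1 by omega)
    exact (h.cast rfl e).trans (ih (by omega) (by omega))

theorem act_succN_of_lt {j : ℕ} (hj : j < n) {i : Fin n} (hi : j < i.1) :
    Eqv (Tm.act (cst i) (Tm.succN j hj)) (Tm.ident unit) unit unit := by
  induction j generalizing i with
  | zero =>
    have h1 : 0 + 1 < n := by omega
    have h := (Eqv.act_cst (T 0 h1) i (Eqv.succ hj)).symm
    rw [T_zero_of_pos hi] at h
    have e : (N ⟨0, hj⟩ : FR n).act (cst i) = unit := actN_cst_of_lt hi
    exact (h.cast e e).trans ((Eqv.act (cst i) (Eqv.T_succ h1)).trans (Eqv.act_ident _ _))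
  | succ j ih =>
    have hG : G j hj i = i := Fin.ext (by rw [G_val, if_neg (by omega)])
    have h := Eqv.act_cst (G j hj) i (Eqv.succN j (by omega))
    rw [hG] at h
    have e : (N ⟨j, by omega⟩ : FR n).act (cst i) = unit :=
      actN_cst_of_lt (show j < i.1 by omega)
    exact (h.cast e e).trans (ih (by omega) (by omega))

theorem act_stdTm_of_le {i j i' j' : Fin n} (h : i ≤ j) (h' : i' ≤ j') (m : ℕ) :
    Eqv (Tm.act (cst i) (stdTm j m)) (Tm.act (cst i') (stdTm j' m)) unit (actN (cst i) j) := by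
  have e := actN_cst_of_le h h'
  induction m with
  | zero => exact (act_zeroN_of_le j.2 h).trans ((act_zeroN_of_le j'.2 h').cast rfl e.symm).symm
  | succ m ih =>
    have hs := (act_succN_of_le j.2 h).trans
      ((act_succN_of_le j'.2 h').cast e.symm e.symm).symm
    have hc := (Eqv.act_comp (cst i') (Eqv.stdTm j' m) (Eqv.succN _ _)).cast rfl e.symm
    have hY : (N j').act (cst i') = actN (cst i) j := e.symm
    rw [hY] at hc
    exact (Eqv.act_comp (cst i) (Eqv.stdTm j m) (Eqv.succN _ _)).trans
      ((Eqv.comp ih hs).trans hc.symm)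

theorem act_stdTm_of_lt {i j : Fin n} (h : j < i) (m : ℕ) :
    Eqv (Tm.act (cst i) (stdTm j m)) (Tm.ident unit) unit unit := by
  have e : (N j).act (cst i) = unit := actN_cst_of_lt h
  induction m with
  | zero => exact act_zeroN_of_lt j.2 h
  | succ m ih =>
    have hc := (Eqv.act_comp (cst i) (Eqv.stdTm j m) (Eqv.succN _ _)).cast rfl e
    rw [e] at hc
    exact hc.trans ((Eqv.comp ih (act_succN_of_lt j.2 h)).trans (Eqv.id_comp (Eqv.ident _)))

/-- The strictness axioms mention only the unitor itself; its inverse follows by uniqueness of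
inverses. -/
theorem Eqv.act_lunInv (φ : Fin n →o Fin n) (X : FR n) :
    Eqv (Tm.act φ (Tm.lunInv X)) (Tm.lunInv (X.act φ)) (X.act φ) (tensor unit (X.act φ)) := by
  have h : Eqv (Tm.act φ (Tm.lunInv X)) (Tm.act φ (Tm.lunInv X)) (X.act φ)
      (tensor unit (X.act φ)) := Eqv.act φ (Eqv.lunInv X)
  have h1 : Eqv (Tm.comp (tensor unit (X.act φ)) (Tm.act φ (Tm.lunInv X)) (Tm.lun (X.act φ)))
      (Tm.ident (X.act φ)) (X.act φ) (X.act φ) :=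
    (Eqv.comp h (Eqv.act_lun φ X).symm).trans
      ((Eqv.act_comp φ (Eqv.lunInv X) (Eqv.lun X)).symm.trans
        ((Eqv.act φ (Eqv.lunInv_lun X)).trans (Eqv.act_ident _ _)))
  exact (Eqv.comp_id h).symm.trans ((Eqv.comp h (Eqv.lun_lunInv _).symm).trans
    ((Eqv.assoc h (Eqv.lun _) (Eqv.lunInv _)).symm.trans
      ((Eqv.comp h1 (Eqv.lunInv _)).trans (Eqv.id_comp (Eqv.lunInv _)))))

theorem Eqv.act_pr (φ : Fin n →o Fin n) {a b : Tm n} {X Y : FR n} (ha : Eqv a a unit X)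
    (hb : Eqv b b unit Y) :
    Eqv (Tm.act φ (FreeRec.pr a b)) (FreeRec.pr (Tm.act φ a) (Tm.act φ b)) unit
      (tensor (X.act φ) (Y.act φ)) :=
  (Eqv.act_comp φ (Eqv.lunInv unit) (Eqv.tens ha hb)).trans
    (Eqv.comp (Eqv.act_lunInv φ unit) (Eqv.act_tens φ ha hb))

/-- Naming values commutes with coercion up to the stage. On a level, `i ≤ m` iff `φ i ≤ j`, where
`N m` is the coerced level, so the two restricted numerals either coincide or are both the identity
of the unit. -/
theorem act_elem (φ : Fin n →o Fin n) (i : Fin n) (X : FR n) (v : Val) :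
    Eqv (Tm.act (cst i) (elem (X.act φ) v)) (Tm.act (cst (φ i)) (elem X v)) unit
      (X.act (cst (φ i))) := by
  induction X generalizing v with
  | unit => exact (Eqv.act_ident (cst i) unit).trans (Eqv.act_ident (cst (φ i)) unit).symm
  | N j =>
    change Eqv (Tm.act (cst i) (elem (actN φ j) v)) (Tm.act (cst (φ i)) (stdTm j v.toNat)) unit
      (actN (cst (φ i)) j)
    rcases actN_cases φ j with ⟨m, hm, h⟩ | ⟨hm, h⟩
    · rw [hm]
      rcases le_or_gt i m with him | him
      · exact (act_stdTm_of_le ((h i).1 him) him _).symm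
      · have hj : j < φ i := not_le.mp fun hj => absurd ((h i).2 hj) (not_le.mpr him)
        rw [actN_cst_of_lt hj]
        exact (act_stdTm_of_lt him _).trans (act_stdTm_of_lt hj _).symm
    · have hj : j < φ i := not_le.mp (h i)
      rw [hm, actN_cst_of_lt hj]
      exact (Eqv.act_ident _ _).trans (act_stdTm_of_lt hj _).symm
  | tensor X Y hX hY =>
    exact ((Eqv.act_pr _ (Eqv.elem _ _) (Eqv.elem _ _)).cast rfl
      (by rw [act_cst, act_cst]; rfl)).trans
      ((Eqv.pr (hX _) (hY _)).trans (Eqv.act_pr _ (Eqv.elem _ _) (Eqv.elem _ _)).symm)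

/-- A numeral is forgotten by the transition map only in a level that `cst i` sends to the unit. -/
theorem act_elem_tr (i : Fin n) (X : FR n) (v : Val) :
    Eqv (Tm.act (cst i) (elem X v)) (Tm.act (cst i) (elem X (tr X i v))) unit
      (X.act (cst i)) := by
  induction X generalizing v with
  | unit => exact Eqv.act _ (Eqv.ident _)
  | N j =>
    rcases le_or_gt i j with h | h
    · simp only [tr, h, if_true]
      exact Eqv.act _ (Eqv.elem _ _)
    · exact ((act_stdTm_of_lt h _).trans (act_stdTm_of_lt h _).symm).cast rfl
        (actN_cst_of_lt h).symm
  | tensor X Y hX hY =>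
    exact (Eqv.act_pr _ (Eqv.elem _ _) (Eqv.elem _ _)).trans
      ((Eqv.pr (hX _) (hY _)).trans (Eqv.act_pr _ (Eqv.elem _ _) (Eqv.elem _ _)).symm)

/-- Two global elements of `X` are equal at stage `i`. -/
structure CEq (i : Fin n) (X : FR n) (a b : Tm n) : Prop where
  left : Eqv a a unit X
  right : Eqv b b unit X
  eqv : Eqv (Tm.act (cst i) a) (Tm.act (cst i) b) unit (X.act (cst i))

namespace CEq

variable {i : Fin n} {X Y : FR n} {a b c a' b' : Tm n}

theorem of_eqv (h : Eqv a b unit X) : CEq i X a b := ⟨h.left, h.right, Eqv.act _ h⟩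

theorem trans (h : CEq i X a b) (h' : CEq i X b c) : CEq i X a c :=
  ⟨h.left, h'.right, h.eqv.trans h'.eqv⟩

theorem comp {f : Tm n} (h : CEq i X a b) (hf : Eqv f f X Y) :
    CEq i Y (Tm.comp X a f) (Tm.comp X b f) :=
  ⟨Eqv.comp h.left hf, Eqv.comp h.right hf,
    (Eqv.act_comp _ h.left hf).trans ((Eqv.comp h.eqv (Eqv.act _ hf)).trans
      (Eqv.act_comp _ h.right hf).symm)⟩

theorem pr (h : CEq i X a b) (h' : CEq i Y a' b') :
    CEq i (tensor X Y) (FreeRec.pr a a') (FreeRec.pr b b') :=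
  ⟨Eqv.pr h.left h'.left, Eqv.pr h.right h'.right,
    (Eqv.act_pr _ h.left h'.left).trans ((Eqv.pr h.eqv h'.eqv).trans
      (Eqv.act_pr _ h.right h'.right).symm)⟩

end CEq

/-! ### Good terms -/

/-- A term `X → Y` is good if its interpretation is a natural transformation which computes its
effect on the global elements named by values. -/
structure Good (f : Tm n) (X Y : FR n) : Prop where
  typed : Eqv f f X Y
  mem : ∀ i v, Mem X i v → Mem Y i (ev f i v)
  natural : ∀ i i' v, i ≤ i' → Mem X i v → tr Y i' (ev f i v) = ev f i' (tr X i' v)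
  -- Equality only at stage `i`: where a level of `Y` is a point, the value retains nothing of the
  -- actual numeral.
  real : ∀ i v, Mem X i v → CEq i Y (Tm.comp X (elem X v) f) (elem Y (ev f i v))

/-- Two terms with source `X` have the same interpretation. -/
def Same (f g : Tm n) (X : FR n) : Prop := ∀ i v, Mem X i v → ev f i v = ev g i v

theorem natural_of_lt {f : Tm n} {X Y : FR n} (hm : ∀ i v, Mem X i v → Mem Y i (ev f i v))
    (h : ∀ i i' v, i < i' → Mem X i v → tr Y i' (ev f i v) = ev f i' (tr X i' v)) :
    ∀ i i' v, i ≤ i' → Mem X i v → tr Y i' (ev f i v) = ev f i' (tr X i' v) := by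
  intro i i' v hi hv
  rcases hi.eq_or_lt with rfl | hi
  · rw [tr_self hv, tr_self (hm i v hv)]
  · exact h i i' v hi hv

namespace Good

variable {f g h : Tm n} {X Y Z W : FR n}

/-- Thanks to this, soundness of an equation needs goodness of one side only, together with equality
of the interpretations. -/
theorem congr (hf : Good f X Y) (he : Eqv f g X Y) (hs : Same f g X) : Good g X Y where
  typed := he.right
  mem i v hv := by
    rw [← hs i v hv]
    exact hf.mem i v hv
  natural i i' v hi hv := by
    rw [← hs i v hv, ← hs i' _ (mem_tr hi hv)]
    exact hf.natural i i' v hi hv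
  real i v hv := by
    rw [← hs i v hv]
    exact (CEq.of_eqv (Eqv.comp (Eqv.elem X v) he.symm)).trans (hf.real i v hv)

theorem ident (X : FR n) : Good (Tm.ident X) X X where
  typed := Eqv.ident X
  mem _ _ hv := hv
  natural _ _ _ _ _ := rfl
  real _ v _ := CEq.of_eqv (Eqv.comp_id (Eqv.elem X v))

theorem comp (hf : Good f X Y) (hg : Good g Y Z) : Good (Tm.comp Y f g) X Z where
  typed := Eqv.comp hf.typed hg.typed
  mem i v hv := hg.mem i _ (hf.mem i v hv)
  natural i i' v hi hv := by
    simp only [ev]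
    rw [hg.natural i i' _ hi (hf.mem i v hv), hf.natural i i' v hi hv]
  real i v hv :=
    (CEq.of_eqv (Eqv.assoc (Eqv.elem X v) hf.typed hg.typed).symm).trans
      (((hf.real i v hv).comp hg.typed).trans (hg.real i _ (hf.mem i v hv)))

theorem tens (hf : Good f X Y) (hg : Good g Z W) :
    Good (Tm.tens f g) (tensor X Z) (tensor Y W) where
  typed := Eqv.tens hf.typed hg.typed
  mem := by
    rintro i _ ⟨a, b, rfl, ha, hb⟩
    exact ⟨_, _, rfl, hf.mem i a ha, hg.mem i b hb⟩
  natural := by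
    rintro i i' _ hi ⟨a, b, rfl, ha, hb⟩
    simp only [ev, tr, fst_pair, snd_pair, hf.natural i i' a hi ha, hg.natural i i' b hi hb]
  real := by
    rintro i _ ⟨a, b, rfl, ha, hb⟩
    exact (CEq.of_eqv (Eqv.pr_tens (Eqv.elem _ _) (Eqv.elem _ _) hf.typed hg.typed)).trans
      ((hf.real i a ha).pr (hg.real i b hb))

theorem lun (X : FR n) : Good (Tm.lun X) (tensor unit X) X where
  typed := Eqv.lun X
  mem := by
    rintro i _ ⟨a, b, rfl, ha, hb⟩
    exact hb
  natural _ _ _ _ _ := rfl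
  real := by
    rintro i _ ⟨a, b, rfl, ha, hb⟩
    exact CEq.of_eqv (Eqv.pr_lun (Eqv.elem _ _))

theorem lunInv (X : FR n) : Good (Tm.lunInv X) X (tensor unit X) where
  typed := Eqv.lunInv X
  mem _ v hv := ⟨_, v, rfl, rfl, hv⟩
  natural _ _ _ _ _ := rfl
  real _ _ _ := CEq.of_eqv (Eqv.comp_lunInv (Eqv.elem _ _))

theorem asc (X Y Z : FR n) :
    Good (Tm.asc X Y Z) (tensor (tensor X Y) Z) (tensor X (tensor Y Z)) where
  typed := Eqv.asc X Y Z
  mem := by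
    rintro i _ ⟨_, c, rfl, ⟨a, b, rfl, ha, hb⟩, hc⟩
    exact ⟨_, _, rfl, ha, _, _, rfl, hb, hc⟩
  natural _ _ _ _ _ := rfl
  real _ _ _ := CEq.of_eqv (Eqv.pr_asc (Eqv.elem _ _) (Eqv.elem _ _) (Eqv.elem _ _))

theorem ascInv (X Y Z : FR n) :
    Good (Tm.ascInv X Y Z) (tensor X (tensor Y Z)) (tensor (tensor X Y) Z) where
  typed := Eqv.ascInv X Y Z
  mem := by
    rintro i _ ⟨a, _, rfl, ha, b, c, rfl, hb, hc⟩
    exact ⟨_, _, rfl, ⟨_, _, rfl, ha, hb⟩, hc⟩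
  natural _ _ _ _ _ := rfl
  real _ _ _ := CEq.of_eqv (Eqv.pr_ascInv (Eqv.elem _ _) (Eqv.elem _ _) (Eqv.elem _ _))

theorem sym (X Y : FR n) : Good (Tm.sym X Y) (tensor X Y) (tensor Y X) where
  typed := Eqv.sym X Y
  mem := by
    rintro i _ ⟨a, b, rfl, ha, hb⟩
    exact ⟨_, _, rfl, hb, ha⟩
  natural _ _ _ _ _ := rfl
  real _ _ _ := CEq.of_eqv (Eqv.pr_sym (Eqv.elem _ _) (Eqv.elem _ _))

theorem runInv (X : FR n) : Good (Tm.runInv X) X (tensor X unit) := (lunInv _).comp (sym _ _)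

theorem act (φ : Fin n →o Fin n) (hf : Good f X Y) : Good (Tm.act φ f) (X.act φ) (Y.act φ) where
  typed := Eqv.act φ hf.typed
  mem i v hv := (mem_act φ Y i _).2 (hf.mem _ _ ((mem_act φ X i v).1 hv))
  natural i i' v hi hv := by
    simp only [ev, tr_act]
    exact hf.natural _ _ v (φ.monotone hi) ((mem_act φ X i v).1 hv)
  real i v hv := by
    have hv' := (mem_act φ X i v).1 hv
    have e1 := Eqv.elem (X.act φ) v
    refine ⟨Eqv.comp e1 (Eqv.act φ hf.typed), Eqv.elem _ _, ?_⟩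
    have h1 := Eqv.act_comp (cst i) e1 (Eqv.act φ hf.typed)
    rw [act_cst, act_cst] at h1
    rw [act_cst]
    exact h1.trans ((Eqv.comp (act_elem φ i X v) (Eqv.act_cst φ i hf.typed)).trans
      ((Eqv.act_comp _ (Eqv.elem X v) hf.typed).symm.trans
        ((hf.real _ _ hv').eqv.trans (act_elem φ i Y _).symm)))

theorem cell {φ ψ : Fin n →o Fin n} (hle : φ ≤ ψ) (X : FR n) :
    Good (Tm.cell φ ψ X) (X.act φ) (X.act ψ) where
  typed := Eqv.cell hle X
  mem i v hv := (mem_act ψ X i _).2 (mem_tr (hle i) ((mem_act φ X i v).1 hv))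
  natural i i' v hi _ := by
    simp only [ev, tr_act]
    rw [tr_tr _ (ψ.monotone hi), tr_tr _ (hle i')]
  real i v hv := by
    have e1 := Eqv.elem (X.act φ) v
    refine ⟨Eqv.comp e1 (Eqv.cell hle X), Eqv.elem _ _, ?_⟩
    have h1 := Eqv.act_comp (cst i) e1 (Eqv.cell hle X)
    have h2 := Eqv.act_cell (cst i) hle X
    rw [act_cst, act_cst] at h1 h2
    rw [act_cst]
    have hle' := cst_le_cst (hle i)
    have e2 : Eqv (Tm.act (cst (ψ i)) (elem X v)) (Tm.act (cst (ψ i)) (elem X v)) unit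
      (X.act (cst (ψ i))) := Eqv.act _ (Eqv.elem X v)
    -- After restriction the cell goes between two constant maps. Naturality moves it across the
    -- global element to the unit, where it is the identity; what remains is the element at stage `ψ
    -- i`, named by the transported value.
    exact h1.trans ((Eqv.comp (act_elem φ i X v) h2).trans
      ((Eqv.cell_nat hle' (Eqv.elem X v)).trans
        ((Eqv.comp (Eqv.cell_unit hle') e2).trans ((Eqv.id_comp e2).trans
          ((act_elem_tr (ψ i) X v).trans (act_elem ψ i X _).symm)))))

theorem zero (h : 0 < n) : Good Tm.zero unit (N ⟨0, h⟩) where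
  typed := Eqv.zero h
  mem i v _ := by
    rcases Nat.eq_zero_or_pos i.1 with hi | hi
    · exact (mem_N_of_le (by rw [Fin.le_def]; exact hi.le) _).2 ⟨0, by simp [ev, hi]⟩
    · exact (mem_N_of_lt hi _).2 (by simp [ev, hi.ne'])
  natural := by
    apply natural_of_lt
    · intro i v _
      rcases Nat.eq_zero_or_pos i.1 with hi | hi
      · exact (mem_N_of_le (by rw [Fin.le_def]; exact hi.le) _).2 ⟨0, by simp [ev, hi]⟩
      · exact (mem_N_of_lt hi _).2 (by simp [ev, hi.ne'])
    · intro i i' v hi _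
      have : 0 < i'.1 := by
        rw [Fin.lt_def] at hi
        omega
      simp [tr, ev, this.ne', Fin.le_def]
  real i v _ := by
    -- Both possible values, `nat 0` and `star`, name the numeral zero.
    have : elem (N ⟨0, h⟩) (ev Tm.zero i v) = Tm.zero := by
      have h0 : (ev Tm.zero i v).toNat = 0 := by
        simp only [ev]
        split_ifs <;> rfl
      simp only [elem, h0]
      rfl
    rw [this]
    exact CEq.of_eqv (Eqv.id_comp (Eqv.zero h))

theorem succ (h : 0 < n) : Good Tm.succ (N ⟨0, h⟩) (N ⟨0, h⟩) := by
  have hm : ∀ (i : Fin n) (v : Val), Mem (N ⟨0, h⟩) i v → Mem (N ⟨0, h⟩) i (ev Tm.succ i v) := by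
    intro i v _
    rcases Nat.eq_zero_or_pos i.1 with hi | hi
    · exact (mem_N_of_le (by rw [Fin.le_def]; exact hi.le) _).2 ⟨v.toNat + 1, by simp [ev, hi]⟩
    · exact (mem_N_of_lt hi _).2 (by simp [ev, hi.ne'])
  refine ⟨Eqv.succ h, hm, natural_of_lt hm ?_, ?_⟩
  · intro i i' v hi _
    have : 0 < i'.1 := by
      rw [Fin.lt_def] at hi
      omega
    simp [tr, ev, this.ne', Fin.le_def]
  · intro i v hv
    rcases Nat.eq_zero_or_pos i.1 with hi | hi
    · simp only [ev, hi, if_true]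
      exact CEq.of_eqv (Eqv.stdTm ⟨0, h⟩ (v.toNat + 1))
    -- Here the value is `star`, which names zero instead of the successor; beyond stage `0` both
    -- restrict to the identity of the unit.
    · refine ⟨Eqv.stdTm ⟨0, h⟩ (v.toNat + 1), Eqv.elem _ _, ?_⟩
      exact ((act_stdTm_of_lt (j := ⟨0, h⟩) hi (v.toNat + 1)).trans
        (act_stdTm_of_lt hi _).symm).cast rfl (actN_cst_of_lt hi).symm

theorem zeroN : ∀ (j : ℕ) (hj : j < n), Good (Tm.zeroN j hj) unit (N ⟨j, hj⟩)
  | 0, hj => zero hj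
  | j + 1, hj => by
    have h := (zeroN j (by omega)).act (G j hj)
    rw [act_G_N_self] at h
    exact h

theorem succN : ∀ (j : ℕ) (hj : j < n), Good (Tm.succN j hj) (N ⟨j, hj⟩) (N ⟨j, hj⟩)
  | 0, hj => succ hj
  | j + 1, hj => by
    have h := (succN j (by omega)).act (G j hj)
    rw [act_G_N_self] at h
    exact h

end Good

/-! ### The recursion schemes -/

theorem mem_N_cases {j i : Fin n} {v : Val} (h : Mem (N j) i v) :
    (i ≤ j ∧ ∃ m, v = nat m) ∨ (j < i ∧ v = star) := by
  rcases le_or_gt i j with hi | hi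
  · exact Or.inl ⟨hi, (mem_N_of_le hi v).1 h⟩
  · exact Or.inr ⟨hi, (mem_N_of_lt hi v).1 h⟩

theorem mem_N_nat {j i : Fin n} (h : i ≤ j) (m : ℕ) : Mem (N j) i (nat m) :=
  (mem_N_of_le h _).2 ⟨m, rfl⟩

/-- Turns the base triangle of a recursion scheme into a computation rule on pairs of global
elements; `Eqv.pr_succ` does the same for the successor triangle. -/
theorem Eqv.pr_zero {j : ℕ} {hj : j < n} {X Y : FR n} {e f g : Tm n} (he : Eqv e e unit X)
    (hf : Eqv f f (tensor (N ⟨j, hj⟩) X) Y) (hg : Eqv g g X Y)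
    (h : Eqv (Tm.comp (tensor (N ⟨j, hj⟩) X) (Tm.tens (Tm.zeroN j hj) (Tm.ident X)) f)
      (Tm.comp X (Tm.lun X) g) (tensor unit X) Y) :
    Eqv (Tm.comp (tensor (N ⟨j, hj⟩) X) (FreeRec.pr (Tm.zeroN j hj) e) f) (Tm.comp X e g)
      unit Y := by
  have hz := Eqv.zeroN j hj
  have hi := Eqv.ident (unit : FR n)
  have h1 : Eqv (FreeRec.pr (Tm.zeroN j hj) e)
      (Tm.comp (tensor unit X) (FreeRec.pr (Tm.ident unit) e)
        (Tm.tens (Tm.zeroN j hj) (Tm.ident X))) unit (tensor (N ⟨j, hj⟩) X) :=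
    (Eqv.pr (Eqv.id_comp hz).symm (Eqv.comp_id he).symm).trans
      (Eqv.pr_tens hi he hz (Eqv.ident X)).symm
  have hp := Eqv.pr hi he
  exact (Eqv.comp h1 hf).trans ((Eqv.assoc hp (Eqv.tens hz (Eqv.ident X)) hf).trans
    ((Eqv.comp hp h).trans ((Eqv.assoc hp (Eqv.lun X) hg).symm.trans
      (Eqv.comp (Eqv.pr_lun he) hg))))

theorem Eqv.pr_succ {j : ℕ} {hj : j < n} {X Y : FR n} {a e f F : Tm n}
    (ha : Eqv a a unit (N ⟨j, hj⟩)) (he : Eqv e e unit X)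
    (hf : Eqv f f (tensor (N ⟨j, hj⟩) X) Y)
    (h : Eqv (Tm.comp (tensor (N ⟨j, hj⟩) X) (Tm.tens (Tm.succN j hj) (Tm.ident X)) f)
      F (tensor (N ⟨j, hj⟩) X) Y) :
    Eqv (Tm.comp (tensor (N ⟨j, hj⟩) X)
        (FreeRec.pr (Tm.comp (N ⟨j, hj⟩) a (Tm.succN j hj)) e) f)
      (Tm.comp (tensor (N ⟨j, hj⟩) X) (FreeRec.pr a e) F) unit Y := by
  have hs := Eqv.succN j hj
  have h1 : Eqv (FreeRec.pr (Tm.comp (N ⟨j, hj⟩) a (Tm.succN j hj)) e)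
      (Tm.comp (tensor (N ⟨j, hj⟩) X) (FreeRec.pr a e)
        (Tm.tens (Tm.succN j hj) (Tm.ident X))) unit (tensor (N ⟨j, hj⟩) X) :=
    (Eqv.pr (Eqv.comp ha hs) (Eqv.comp_id he).symm).trans
      (Eqv.pr_tens ha he hs (Eqv.ident X)).symm
  have hp := Eqv.pr ha he
  exact (Eqv.comp h1 hf).trans ((Eqv.assoc hp (Eqv.tens hs (Eqv.ident X)) hf).trans
    (Eqv.comp hp h))

/-! ### Flat recursion in the model -/

section Flat

variable {h0 : 0 < n} {X Y : FR n} {f g h g' h' : Tm n}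

/-- Naturality is free, since the target is a point at every stage later than another one.
Realization is a case distinction on the counter, because `h` does not use the recursive value. -/
theorem Good.flat (hY : Y.IsPowZero) (gg : Good g X Y) (gh : Good h (tensor (N ⟨0, h0⟩) X) Y)
    (hf : Eqv (Tm.flat g h) (Tm.flat g h) (tensor (N ⟨0, h0⟩) X) Y)
    (hz : Eqv (Tm.comp (tensor (N ⟨0, h0⟩) X) (Tm.tens Tm.zero (Tm.ident X)) (Tm.flat g h))
      (Tm.comp X (Tm.lun X) g) (tensor unit X) Y)
    (hs : Eqv (Tm.comp (tensor (N ⟨0, h0⟩) X) (Tm.tens Tm.succ (Tm.ident X)) (Tm.flat g h))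
      h (tensor (N ⟨0, h0⟩) X) Y) :
    Good (Tm.flat g h) (tensor (N ⟨0, h0⟩) X) Y := by
  have hm : ∀ i v, Mem (tensor (N ⟨0, h0⟩) X) i v → Mem Y i (ev (Tm.flat g h) i v) := by
    rintro i _ ⟨a, x, rfl, ha, hx⟩
    rcases mem_N_cases ha with ⟨hi, m, rfl⟩ | ⟨hi, rfl⟩
    · cases m with
      | zero => exact gg.mem i x hx
      | succ m => exact gh.mem i _ ⟨_, _, rfl, mem_N_nat hi m, hx⟩
    · exact gg.mem i x hx
  refine ⟨hf, hm, natural_of_lt hm ?_, ?_⟩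
  · intro i i' v hi hv
    exact hY.trivial (lt_of_le_of_lt (Nat.zero_le _) hi) _ _ (mem_tr hi.le (hm i v hv))
      (hm i' _ (mem_tr hi.le hv))
  · rintro i _ ⟨a, x, rfl, ha, hx⟩
    have hzero : CEq i Y (Tm.comp (tensor (N ⟨0, h0⟩) X)
        (FreeRec.pr (Tm.zeroN 0 h0) (elem X x)) (Tm.flat g h)) (elem Y (ev g i x)) :=
      (CEq.of_eqv (Eqv.pr_zero (Eqv.elem X x) hf gg.typed hz)).trans (gg.real i x hx)
    rcases mem_N_cases ha with ⟨hi, m, rfl⟩ | ⟨hi, rfl⟩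
    · cases m with
      | zero => exact hzero
      | succ m =>
        exact (CEq.of_eqv (Eqv.pr_succ (Eqv.stdTm ⟨0, h0⟩ m) (Eqv.elem X x) hf hs)).trans
          (gh.real i (pair (nat m) x) ⟨_, _, rfl, mem_N_nat hi m, hx⟩)
    · exact hzero

theorem Same.flat (sg : Same g g' X) (sh : Same h h' (tensor (N ⟨0, h0⟩) X)) :
    Same (Tm.flat g h) (Tm.flat g' h') (tensor (N ⟨0, h0⟩) X) := by
  rintro i _ ⟨a, x, rfl, ha, hx⟩
  rcases mem_N_cases ha with ⟨hi, m, rfl⟩ | ⟨hi, rfl⟩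
  · cases m with
    | zero => exact sg i x hx
    | succ m => exact sh i _ ⟨_, _, rfl, mem_N_nat hi m, hx⟩
  · exact sg i x hx

/-- Beyond stage `0` the successor returns `star` and the recursor returns `g`; this agrees with `h`
only because powers of `N 0` are points there. -/
theorem same_flat_succ (hY : Y.IsPowZero) (gg : Good g X Y)
    (gh : Good h (tensor (N ⟨0, h0⟩) X) Y) :
    Same (Tm.comp (tensor (N ⟨0, h0⟩) X) (Tm.tens Tm.succ (Tm.ident X)) (Tm.flat g h))
      h (tensor (N ⟨0, h0⟩) X) := by
  rintro i v hv
  obtain ⟨a, x, rfl, ha, hx⟩ := id hv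
  rcases mem_N_cases ha with ⟨hi, m, rfl⟩ | ⟨hi, rfl⟩
  · have : i.1 = 0 := Nat.le_zero.1 hi
    simp [ev, this]
  · have hi' : 0 < i.1 := hi
    simp only [ev, fst_pair, snd_pair, hi'.ne', if_false, toNat_star]
    exact hY.trivial hi _ _ (gg.mem i x hx) (gh.mem i _ hv)

theorem same_flat_uniq
    (hz : Same (Tm.comp (tensor (N ⟨0, h0⟩) X) (Tm.tens Tm.zero (Tm.ident X)) f)
      (Tm.comp X (Tm.lun X) g) (tensor unit X))
    (hs : Same (Tm.comp (tensor (N ⟨0, h0⟩) X) (Tm.tens Tm.succ (Tm.ident X)) f) h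
      (tensor (N ⟨0, h0⟩) X)) :
    Same f (Tm.flat g h) (tensor (N ⟨0, h0⟩) X) := by
  rintro i _ ⟨a, x, rfl, ha, hx⟩
  have hz' := hz i (pair star x) ⟨_, _, rfl, rfl, hx⟩
  rcases mem_N_cases ha with ⟨hi, m, rfl⟩ | ⟨hi, rfl⟩
  · have hi0 : i.1 = 0 := Nat.le_zero.1 hi
    cases m with
    | zero => simpa [ev, hi0] using hz'
    | succ m =>
      simpa [ev, hi0] using hs i (pair (nat m) x) ⟨_, _, rfl, mem_N_nat hi m, hx⟩
  · have hi' : 0 < i.1 := hi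
    simpa [ev, hi'.ne'] using hz'

end Flat

/-! ### Safe ramified recursion in the model -/

section SRR

variable {k : ℕ} {hk : k + 1 < n} {X Y : FR n} {f g h g' h' : Tm n}

/-- A transition to a stage beyond `k` lands in a point of `Y`. A transition to a stage at most `k`
keeps the counter, and naturality follows by induction on it. Realization is the same induction,
unfolding the recursor on numerals by the two triangles. -/
theorem Good.srr (hY : ∀ i : Fin n, k < i.1 → Trivial Y i) (gg : Good g X Y) (gh : Good h Y Y)
    (hf : Eqv (Tm.srr k g h) (Tm.srr k g h) (tensor (N ⟨k + 1, hk⟩) X) Y)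
    (hz : Eqv (Tm.comp (tensor (N ⟨k + 1, hk⟩) X)
        (Tm.tens (Tm.zeroN (k + 1) hk) (Tm.ident X)) (Tm.srr k g h))
      (Tm.comp X (Tm.lun X) g) (tensor unit X) Y)
    (hs : Eqv (Tm.comp (tensor (N ⟨k + 1, hk⟩) X)
        (Tm.tens (Tm.succN (k + 1) hk) (Tm.ident X)) (Tm.srr k g h))
      (Tm.comp Y (Tm.srr k g h) h) (tensor (N ⟨k + 1, hk⟩) X) Y) :
    Good (Tm.srr k g h) (tensor (N ⟨k + 1, hk⟩) X) Y := by
  have hm' : ∀ i x, Mem X i x → ∀ m, Mem Y i (ev (Tm.srr k g h) i (pair (nat m) x)) := by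
    intro i x hx m
    induction m with
    | zero => exact gg.mem i x hx
    | succ m ih => exact gh.mem i _ ih
  have hm : ∀ i v, Mem (tensor (N ⟨k + 1, hk⟩) X) i v → Mem Y i (ev (Tm.srr k g h) i v) := by
    rintro i _ ⟨a, x, rfl, ha, hx⟩
    rcases mem_N_cases ha with ⟨hi, m, rfl⟩ | ⟨hi, rfl⟩
    · exact hm' i x hx m
    · exact gg.mem i x hx
  refine ⟨hf, hm, natural_of_lt hm ?_, ?_⟩
  · intro i i' v hi hv
    rcases Nat.lt_or_ge k i'.1 with hk' | hk'
    · exact hY i' hk' _ _ (mem_tr hi.le (hm i v hv)) (hm i' _ (mem_tr hi.le hv))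
    · obtain ⟨a, x, rfl, ha, hx⟩ := hv
      have hi' : i' ≤ ⟨k + 1, hk⟩ := Nat.le_succ_of_le hk'
      obtain ⟨m, rfl⟩ := (mem_N_of_le (hi.le.trans hi') a).1 ha
      simp only [tr, fst_pair, snd_pair, hi', if_true]
      induction m with
      | zero => exact gg.natural i i' x hi.le hx
      | succ m ih =>
        refine (gh.natural i i' _ hi.le (hm' i x hx m)).trans ?_
        rw [ih (mem_N_nat (hi.le.trans hi') m)]
        rfl
  · rintro i _ ⟨a, x, rfl, ha, hx⟩
    have hzero : CEq i Y (Tm.comp (tensor (N ⟨k + 1, hk⟩) X)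
        (FreeRec.pr (Tm.zeroN (k + 1) hk) (elem X x)) (Tm.srr k g h)) (elem Y (ev g i x)) :=
      (CEq.of_eqv (Eqv.pr_zero (Eqv.elem X x) hf gg.typed hz)).trans (gg.real i x hx)
    rcases mem_N_cases ha with ⟨hi, m, rfl⟩ | ⟨hi, rfl⟩
    · clear ha
      induction m with
      | zero => exact hzero
      | succ m ih =>
        have hp := Eqv.elem (tensor (N ⟨k + 1, hk⟩) X) (pair (nat m) x)
        exact (CEq.of_eqv ((Eqv.pr_succ (Eqv.stdTm ⟨k + 1, hk⟩ m) (Eqv.elem X x) hf hs).trans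
          (Eqv.assoc hp hf gh.typed).symm)).trans
          ((ih.comp gh.typed).trans (gh.real i _ (hm' i x hx m)))
    · exact hzero

theorem Same.srr (gg : Good g X Y) (gh : Good h Y Y) (sg : Same g g' X) (sh : Same h h' Y) :
    Same (Tm.srr k g h) (Tm.srr k g' h') (tensor (N ⟨k + 1, hk⟩) X) := by
  rintro i _ ⟨a, x, rfl, -, hx⟩
  simp only [ev, fst_pair, snd_pair]
  generalize a.toNat = m
  -- Membership is carried along because `h` and `h'` agree only on values of `Y`.
  have : ev (Tm.srr k g h) i (pair (nat m) x) = ev (Tm.srr k g' h') i (pair (nat m) x) ∧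
      Mem Y i (ev (Tm.srr k g h) i (pair (nat m) x)) := by
    induction m with
    | zero => exact ⟨sg i x hx, gg.mem i x hx⟩
    | succ m ih =>
      refine ⟨(sh i _ ih.2).trans ?_, gh.mem i _ ih.2⟩
      rw [ih.1]
      rfl
  exact this.1

theorem same_srr_zero :
    Same (Tm.comp (tensor (N ⟨k + 1, hk⟩) X)
        (Tm.tens (Tm.zeroN (k + 1) hk) (Tm.ident X)) (Tm.srr k g h))
      (Tm.comp X (Tm.lun X) g) (tensor unit X) := by
  rintro i _ ⟨a, x, rfl, -, hx⟩
  simp only [ev, fst_pair, snd_pair, ev_zeroN]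
  split_ifs <;> rfl

/-- Beyond stage `k + 1` the counter is stuck at `star`, so one side gives `g` and the other `h`
after `g`; safety of `Y` identifies them. -/
theorem same_srr_succ (hY : ∀ i : Fin n, k < i.1 → Trivial Y i) (gg : Good g X Y)
    (gh : Good h Y Y) :
    Same (Tm.comp (tensor (N ⟨k + 1, hk⟩) X)
        (Tm.tens (Tm.succN (k + 1) hk) (Tm.ident X)) (Tm.srr k g h))
      (Tm.comp Y (Tm.srr k g h) h) (tensor (N ⟨k + 1, hk⟩) X) := by
  rintro i _ ⟨a, x, rfl, ha, hx⟩
  rcases mem_N_cases ha with ⟨hi, m, rfl⟩ | ⟨hi, rfl⟩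
  · have hi' : i.1 ≤ k + 1 := hi
    simp [ev, ev_succN, hi']
  · have hi' : k + 1 < i.1 := hi
    simp only [ev, fst_pair, snd_pair, ev_succN, hi'.not_ge, if_false, toNat_star]
    exact hY i (by omega) _ _ (gg.mem i x hx) (gh.mem i _ (gg.mem i x hx))

theorem same_srr_uniq
    (hz : Same (Tm.comp (tensor (N ⟨k + 1, hk⟩) X)
        (Tm.tens (Tm.zeroN (k + 1) hk) (Tm.ident X)) f)
      (Tm.comp X (Tm.lun X) g) (tensor unit X))
    (hs : Same (Tm.comp (tensor (N ⟨k + 1, hk⟩) X)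
        (Tm.tens (Tm.succN (k + 1) hk) (Tm.ident X)) f)
      (Tm.comp Y f h) (tensor (N ⟨k + 1, hk⟩) X)) :
    Same f (Tm.srr k g h) (tensor (N ⟨k + 1, hk⟩) X) := by
  rintro i _ ⟨a, x, rfl, ha, hx⟩
  have hz' := hz i (pair star x) ⟨_, _, rfl, rfl, hx⟩
  rcases mem_N_cases ha with ⟨hi, m, rfl⟩ | ⟨hi, rfl⟩
  · have hi' : i.1 ≤ k + 1 := hi
    clear ha
    induction m with
    | zero => simpa [ev, ev_zeroN, hi'] using hz'
    | succ m ih =>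
      have hs' := hs i (pair (nat m) x) ⟨_, _, rfl, mem_N_nat hi m, hx⟩
      simp only [ev, ev_succN, hi', if_true, fst_pair, snd_pair, toNat_nat, ih] at hs'
      exact hs'
  · have hi' : k + 1 < i.1 := hi
    simpa [ev, ev_zeroN, hi'.not_ge] using hz'

end SRR

/-! ### Diagonals -/

/-- The semantic content of the safety condition: beyond stage `k` the erased object has the same
values as `Y`, and its identity factors through the point. -/
theorem trivial_of_low {k : ℕ} {hk : k + 1 < n} {Y : FR n} {a b : Tm n}
    (ga : Good a (low k hk Y) unit)
    (he : Same (Tm.comp unit a b) (Tm.ident (low k hk Y)) (low k hk Y)) (i : Fin n)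
    (hi : k < i.1) : Trivial Y i := by
  intro v w hv hw
  rw [← mem_low hk Y hi] at hv hw
  have h1 : ev a i v = star := ga.mem i v hv
  have h2 : ev a i w = star := ga.mem i w hw
  have h3 := he i v hv
  have h4 := he i w hw
  simp only [ev, h1] at h3
  simp only [ev, h2] at h4
  rw [← h3, h4]

theorem low_tensor {k : ℕ} (hk : k + 1 < n) (X Y : FR n) :
    low k hk (tensor X Y) = tensor (low k hk X) (low k hk Y) := by
  induction k generalizing X Y with
  | zero => rfl
  | succ k ih => exact ih _ _ _

theorem low_N {k : ℕ} (hk : k + 1 < n) : low k hk (N ⟨k, by omega⟩) = unit := by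
  induction k with
  | zero => exact act_T_N_zero hk
  | succ k ih =>
    rw [low, act_T_N, if_pos rfl, if_neg (Nat.succ_ne_zero k)]
    exact ih _

theorem low_N_N {k : ℕ} (hk : k + 1 < n) :
    low k hk (tensor (N ⟨k, by omega⟩) (N ⟨k, by omega⟩)) = tensor unit unit := by
  rw [low_tensor, low_N]

theorem trivial_N {k : ℕ} (hk : k < n) (i : Fin n) (hi : k < i.1) : Trivial (N ⟨k, hk⟩) i := by
  intro a b ha hb
  rw [mem_N_of_lt hi] at ha hb
  rw [ha, hb]

theorem trivial_tensor {X Y : FR n} {i : Fin n} (hX : Trivial X i) (hY : Trivial Y i) :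
    Trivial (tensor X Y) i := by
  rintro _ _ ⟨a, b, rfl, ha, hb⟩ ⟨a', b', rfl, ha', hb'⟩
  rw [hX _ _ ha ha', hY _ _ hb hb']

theorem Good.dup (k : ℕ) (hk : k + 1 < n) :
    Good (Tm.dup k hk) (N ⟨k + 1, hk⟩) (tensor (N ⟨k, by omega⟩) (N ⟨k, by omega⟩)) := by
  have gz := Good.zeroN k (by omega : k < n)
  have gs := Good.succN k (by omega : k < n)
  have g0 := (Good.lunInv (n := n) unit).comp (gz.tens gz)
  have g1 := gs.tens gs
  have e := low_N_N hk
  have h1 : Eqv (Tm.lun unit) (Tm.lun unit)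
      (low k hk (tensor (N ⟨k, by omega⟩) (N ⟨k, by omega⟩))) unit := by
    rw [e]
    exact Eqv.lun _
  have h2 : Eqv (Tm.lunInv unit) (Tm.lunInv unit) unit
      (low k hk (tensor (N ⟨k, by omega⟩) (N ⟨k, by omega⟩))) := by
    rw [e]
    exact Eqv.lunInv _
  have h3 : Eqv (Tm.comp unit (Tm.lun unit) (Tm.lunInv unit))
      (Tm.ident (low k hk (tensor (N ⟨k, by omega⟩) (N ⟨k, by omega⟩))))
      (low k hk (tensor (N ⟨k, by omega⟩) (N ⟨k, by omega⟩)))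
      (low k hk (tensor (N ⟨k, by omega⟩) (N ⟨k, by omega⟩))) := by
    rw [e]
    exact Eqv.lun_lunInv _
  have h4 : Eqv (Tm.comp (low k hk (tensor (N ⟨k, by omega⟩) (N ⟨k, by omega⟩)))
      (Tm.lunInv unit) (Tm.lun unit)) (Tm.ident unit) unit unit := by
    rw [e]
    exact Eqv.lunInv_lun _
  exact (Good.runInv _).comp (Good.srr
    (fun i hi => trivial_tensor (trivial_N _ i hi) (trivial_N _ i hi)) g0 g1
    (Eqv.srr hk h1 h2 h3 h4 g0.typed g1.typed) (Eqv.srr_zero hk h1 h2 h3 h4 g0.typed g1.typed)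
    (Eqv.srr_succ hk h1 h2 h3 h4 g0.typed g1.typed))

/-- The bound on the stage is essential: at stage `k + 1` the source is still ℕ, but the target is a
point. -/
theorem ev_dup (k : ℕ) (hk : k + 1 < n) (i : Fin n) (hi : i.1 ≤ k) (m : ℕ) :
    ev (Tm.dup k hk) i (nat m) = pair (nat m) (nat m) := by
  have : ∀ v, ev (Tm.srr k
      (Tm.comp (tensor unit unit) (Tm.lunInv unit)
        (Tm.tens (Tm.zeroN k (by omega)) (Tm.zeroN k (by omega))))
      (Tm.tens (Tm.succN k (by omega)) (Tm.succN k (by omega)))) i (pair (nat m) v) =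
        pair (nat m) (nat m) := by
    intro v
    induction m with
    | zero => simp [ev, ev_zeroN, hi]
    | succ m ih =>
      simp only [ev, fst_pair, snd_pair, toNat_nat, ev_zeroN, ev_succN, hi, if_true] at ih ⊢
      rw [ih]
      simp
  exact this _

theorem ev_dup_star (k : ℕ) (hk : k + 1 < n) (i : Fin n) (hi : k < i.1) :
    ev (Tm.dup k hk) i star = pair star star := by
  simp [Tm.dup, Tm.runInv, ev, ev_zeroN, hi.not_ge]

theorem Good.act_G_dup (k : ℕ) (hk : k + 1 < n) :
    Good (Tm.act (FreeRec.G k hk) (Tm.dup k hk)) (N ⟨k + 1, hk⟩)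
      (tensor (N ⟨k + 1, hk⟩) (N ⟨k + 1, hk⟩)) := by
  have h := (Good.dup k hk).act (FreeRec.G k hk)
  have e1 : (N ⟨k + 1, hk⟩ : FR n).act (FreeRec.G k hk) = N ⟨k + 1, hk⟩ := by
    rw [act_G_N, if_neg (Nat.succ_ne_self k)]
  simp only [FR.act] at h
  change Good _ ((N ⟨k + 1, hk⟩ : FR n).act (FreeRec.G k hk))
    (tensor ((N ⟨k, by omega⟩ : FR n).act (FreeRec.G k hk))
      ((N ⟨k, by omega⟩ : FR n).act (FreeRec.G k hk))) at h
  rw [e1, act_G_N_self] at h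
  exact h

/-- `G k` never takes the value `k + 1`, so it skips the only stage at which `dup k` fails to
duplicate. -/
theorem ev_act_G_dup (k : ℕ) (hk : k + 1 < n) (i : Fin n) (v : Val)
    (hv : Mem (N ⟨k + 1, hk⟩) i v) :
    ev (Tm.act (FreeRec.G k hk) (Tm.dup k hk)) i v = pair v v := by
  rcases mem_N_cases hv with ⟨hi, m, rfl⟩ | ⟨hi, rfl⟩
  · exact ev_dup k hk _ ((G_le_iff k hk i).2 hi) m
  · refine ev_dup_star k hk _ ?_
    have hi' : k + 1 < i.1 := hi
    have := (G_le_iff k hk i).not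
    omega

theorem T_one_N_one (hn : 2 < n) : (N ⟨1, by omega⟩ : FR n).act (T 1 (by omega)) =
    N ⟨0, by omega⟩ := by
  rw [act_T_N, if_pos rfl, if_neg one_ne_zero]

theorem Good.deltaN (hn : 2 < n) : ∀ (j : ℕ) (hj : j < n),
    Good (Tm.deltaN hn j hj) (N ⟨j, hj⟩) (tensor (N ⟨j, hj⟩) (N ⟨j, hj⟩))
  | 0, _ => by
    have h := (Good.act_G_dup 0 (by omega : 0 + 1 < n)).act (T 1 (by omega))
    change Good _ ((N ⟨1, by omega⟩ : FR n).act (T 1 (by omega)))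
      (tensor ((N ⟨1, by omega⟩ : FR n).act (T 1 (by omega)))
        ((N ⟨1, by omega⟩ : FR n).act (T 1 (by omega)))) at h
    rw [T_one_N_one hn] at h
    exact h
  | k + 1, hj => Good.act_G_dup k hj

theorem ev_deltaN (hn : 2 < n) : ∀ (j : ℕ) (hj : j < n) (i : Fin n) (v : Val),
    Mem (N ⟨j, hj⟩) i v → ev (Tm.deltaN hn j hj) i v = pair v v
  | 0, _, i, v, hv => by
    refine ev_act_G_dup 0 (by omega : 0 + 1 < n) (T 1 (by omega) i) v ?_
    rw [← mem_act (T 1 (by omega)) (N ⟨0 + 1, by omega⟩) i v]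
    have e := T_one_N_one hn
    change Mem ((N ⟨1, by omega⟩ : FR n).act (T 1 (by omega))) i v
    rw [e]
    exact hv
  | k + 1, hj, i, v, hv => ev_act_G_dup k hj i v hv

theorem Good.mid (X Y : FR n) :
    Good (Tm.mid X Y) (tensor (tensor X X) (tensor Y Y)) (tensor (tensor X Y) (tensor X Y)) :=
  (Good.asc _ _ _).comp (((Good.ident X).tens ((Good.ascInv _ _ _).comp
    (((Good.sym _ _).tens (Good.ident Y)).comp (Good.asc _ _ _)))).comp (Good.ascInv _ _ _))

theorem Good.delta (hn : 2 < n) (X : FR n) : Good (Tm.delta hn X) X (tensor X X) := by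
  induction X with
  | unit => exact Good.lunInv _
  | N j => exact Good.deltaN hn j.1 j.2
  | tensor X Y hX hY => exact (hX.tens hY).comp (Good.mid X Y)

/-- This makes the successor equation of dependent recursion ordinary primitive recursion in the
model. -/
theorem ev_delta (hn : 2 < n) (X : FR n) (i : Fin n) (v : Val) (hv : Mem X i v) :
    ev (Tm.delta hn X) i v = pair v v := by
  induction X generalizing v with
  | unit =>
    obtain rfl : v = star := hv
    rfl
  | N j => exact ev_deltaN hn j.1 j.2 i v hv
  | tensor X Y hX hY =>
    obtain ⟨a, b, rfl, ha, hb⟩ := hv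
    simp [Tm.delta, Tm.mid, ev, hX a ha, hY b hb]

/-! ### Safe dependent recursion in the model -/

section SDR

variable (hn : 2 < n) {k : ℕ} {hk : k + 1 < n} {X Y : FR n} {f g h g' h' : Tm n}

theorem Good.sdr (hY : ∀ i : Fin n, k < i.1 → Trivial Y i) (gg : Good g X Y)
    (gh : Good h (tensor (tensor (N ⟨k + 1, hk⟩) X) Y) Y)
    (hf : Eqv (Tm.sdr k g h) (Tm.sdr k g h) (tensor (N ⟨k + 1, hk⟩) X) Y)
    (hz : Eqv (Tm.comp (tensor (N ⟨k + 1, hk⟩) X)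
        (Tm.tens (Tm.zeroN (k + 1) hk) (Tm.ident X)) (Tm.sdr k g h))
      (Tm.comp X (Tm.lun X) g) (tensor unit X) Y)
    (hs : Eqv (Tm.comp (tensor (N ⟨k + 1, hk⟩) X)
        (Tm.tens (Tm.succN (k + 1) hk) (Tm.ident X)) (Tm.sdr k g h))
      (Tm.comp (tensor (tensor (N ⟨k + 1, hk⟩) X) (tensor (N ⟨k + 1, hk⟩) X))
        (Tm.delta hn (tensor (N ⟨k + 1, hk⟩) X))
        (Tm.comp (tensor (tensor (N ⟨k + 1, hk⟩) X) Y)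
          (Tm.tens (Tm.ident (tensor (N ⟨k + 1, hk⟩) X)) (Tm.sdr k g h)) h))
      (tensor (N ⟨k + 1, hk⟩) X) Y) :
    Good (Tm.sdr k g h) (tensor (N ⟨k + 1, hk⟩) X) Y := by
  -- The bound on `i` is needed because `h` also receives the counter, which must belong to the
  -- level.
  have hm' : ∀ i x, i ≤ ⟨k + 1, hk⟩ → Mem X i x → ∀ m,
      Mem Y i (ev (Tm.sdr k g h) i (pair (nat m) x)) := by
    intro i x hi hx m
    induction m with
    | zero => exact gg.mem i x hx
    | succ m ih => exact gh.mem i _ ⟨_, _, rfl, ⟨_, _, rfl, mem_N_nat hi m, hx⟩, ih⟩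
  have hm : ∀ i v, Mem (tensor (N ⟨k + 1, hk⟩) X) i v → Mem Y i (ev (Tm.sdr k g h) i v) := by
    rintro i _ ⟨a, x, rfl, ha, hx⟩
    rcases mem_N_cases ha with ⟨hi, m, rfl⟩ | ⟨hi, rfl⟩
    · exact hm' i x hi hx m
    · exact gg.mem i x hx
  refine ⟨hf, hm, natural_of_lt hm ?_, ?_⟩
  · intro i i' v hi hv
    rcases Nat.lt_or_ge k i'.1 with hk' | hk'
    · exact hY i' hk' _ _ (mem_tr hi.le (hm i v hv)) (hm i' _ (mem_tr hi.le hv))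
    · obtain ⟨a, x, rfl, ha, hx⟩ := hv
      have hi' : i' ≤ ⟨k + 1, hk⟩ := Nat.le_succ_of_le hk'
      obtain ⟨m, rfl⟩ := (mem_N_of_le (hi.le.trans hi') a).1 ha
      simp only [tr, fst_pair, snd_pair, hi', if_true]
      induction m with
      | zero => exact gg.natural i i' x hi.le hx
      | succ m ih =>
        have hn' := mem_N_nat (hi.le.trans hi') m
        refine (gh.natural i i' _ hi.le
          ⟨_, _, rfl, ⟨_, _, rfl, hn', hx⟩, hm' i x (hi.le.trans hi') hx m⟩).trans ?_
        simp only [tr, fst_pair, snd_pair, hi', if_true]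
        exact congrArg (fun y => ev h i' (pair (pair (nat m) (tr X i' x)) y)) (ih hn')
  · rintro i _ ⟨a, x, rfl, ha, hx⟩
    have hzero : CEq i Y (Tm.comp (tensor (N ⟨k + 1, hk⟩) X)
        (FreeRec.pr (Tm.zeroN (k + 1) hk) (elem X x)) (Tm.sdr k g h)) (elem Y (ev g i x)) :=
      (CEq.of_eqv (Eqv.pr_zero (Eqv.elem X x) hf gg.typed hz)).trans (gg.real i x hx)
    rcases mem_N_cases ha with ⟨hi, m, rfl⟩ | ⟨hi, rfl⟩
    · clear ha
      induction m with
      | zero => exact hzero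
      | succ m ih =>
        have hp := Eqv.elem (tensor (N ⟨k + 1, hk⟩) X) (pair (nat m) x)
        have hv : Mem (tensor (N ⟨k + 1, hk⟩) X) i (pair (nat m) x) :=
          ⟨_, _, rfl, mem_N_nat hi m, hx⟩
        have gd := Good.delta hn (tensor (N ⟨k + 1, hk⟩) X)
        have hI := Eqv.ident (tensor (N ⟨k + 1, hk⟩) X)
        have hT := Eqv.tens hI hf
        -- The formal diagonal is known to duplicate a named element only at stage `i`; equality at
        -- a stage is all the conclusion requires.
        have hd := gd.real i _ hv
        rw [ev_delta hn _ i _ hv] at hd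
        have h1 := (CEq.of_eqv (i := i) ((Eqv.pr_succ (Eqv.stdTm ⟨k + 1, hk⟩ m) (Eqv.elem X x)
          hf hs).trans (Eqv.assoc hp gd.typed (Eqv.comp hT gh.typed)).symm)).trans
          (hd.comp (Eqv.comp hT gh.typed))
        have h2 : CEq i (tensor (tensor (N ⟨k + 1, hk⟩) X) Y) _ (elem (tensor (tensor (N ⟨k + 1, hk⟩) X) Y)
            (pair (pair (nat m) x) (ev (Tm.sdr k g h) i (pair (nat m) x)))) :=
          (CEq.of_eqv ((Eqv.pr_tens hp hp hI hf).trans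
            (Eqv.pr (Eqv.comp_id hp) (Eqv.comp hp hf)))).trans
          ((CEq.of_eqv hp).pr ih)
        exact h1.trans ((CEq.of_eqv (Eqv.assoc (Eqv.pr hp hp) hT gh.typed).symm).trans
          ((h2.comp gh.typed).trans (gh.real i _ ⟨_, _, rfl, hv, hm' i x hi hx m⟩)))
    · exact hzero

theorem Same.sdr (gg : Good g X Y) (gh : Good h (tensor (tensor (N ⟨k + 1, hk⟩) X) Y) Y)
    (sg : Same g g' X) (sh : Same h h' (tensor (tensor (N ⟨k + 1, hk⟩) X) Y)) :
    Same (Tm.sdr k g h) (Tm.sdr k g' h') (tensor (N ⟨k + 1, hk⟩) X) := by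
  rintro i _ ⟨a, x, rfl, ha, hx⟩
  rcases mem_N_cases ha with ⟨hi, m, rfl⟩ | ⟨hi, rfl⟩
  · have : ev (Tm.sdr k g h) i (pair (nat m) x) = ev (Tm.sdr k g' h') i (pair (nat m) x) ∧
        Mem Y i (ev (Tm.sdr k g h) i (pair (nat m) x)) := by
      clear ha
      induction m with
      | zero => exact ⟨sg i x hx, gg.mem i x hx⟩
      | succ m ih =>
        have hv : Mem (tensor (tensor (N ⟨k + 1, hk⟩) X) Y) i
            (pair (pair (nat m) x) (ev (Tm.sdr k g h) i (pair (nat m) x))) :=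
          ⟨_, _, rfl, ⟨_, _, rfl, mem_N_nat hi m, hx⟩, ih.2⟩
        refine ⟨(sh i _ hv).trans ?_, gh.mem i _ hv⟩
        rw [ih.1]
        rfl
    exact this.1
  · exact sg i x hx

theorem same_sdr_zero :
    Same (Tm.comp (tensor (N ⟨k + 1, hk⟩) X)
        (Tm.tens (Tm.zeroN (k + 1) hk) (Tm.ident X)) (Tm.sdr k g h))
      (Tm.comp X (Tm.lun X) g) (tensor unit X) := by
  rintro i _ ⟨a, x, rfl, -, hx⟩
  simp only [ev, fst_pair, snd_pair, ev_zeroN]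
  split_ifs <;> rfl

theorem same_sdr_succ (hY : ∀ i : Fin n, k < i.1 → Trivial Y i) (gg : Good g X Y)
    (gh : Good h (tensor (tensor (N ⟨k + 1, hk⟩) X) Y) Y) :
    Same (Tm.comp (tensor (N ⟨k + 1, hk⟩) X)
        (Tm.tens (Tm.succN (k + 1) hk) (Tm.ident X)) (Tm.sdr k g h))
      (Tm.comp (tensor (tensor (N ⟨k + 1, hk⟩) X) (tensor (N ⟨k + 1, hk⟩) X))
        (Tm.delta hn (tensor (N ⟨k + 1, hk⟩) X))
        (Tm.comp (tensor (tensor (N ⟨k + 1, hk⟩) X) Y)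
          (Tm.tens (Tm.ident (tensor (N ⟨k + 1, hk⟩) X)) (Tm.sdr k g h)) h))
      (tensor (N ⟨k + 1, hk⟩) X) := by
  intro i v hv
  have hd := ev_delta hn _ i v hv
  obtain ⟨a, x, rfl, ha, hx⟩ := id hv
  rcases mem_N_cases ha with ⟨hi, m, rfl⟩ | ⟨hi, rfl⟩
  · have hi' : i.1 ≤ k + 1 := hi
    simp [ev, ev_succN, hi', hd]
  · have hi' : k + 1 < i.1 := hi
    simp only [ev, fst_pair, snd_pair, ev_succN, hi'.not_ge, if_false, toNat_star, hd]
    exact hY i (by omega) _ _ (gg.mem i x hx) (gh.mem i _ ⟨_, _, rfl, hv, gg.mem i x hx⟩)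

theorem same_sdr_uniq
    (hz : Same (Tm.comp (tensor (N ⟨k + 1, hk⟩) X)
        (Tm.tens (Tm.zeroN (k + 1) hk) (Tm.ident X)) f)
      (Tm.comp X (Tm.lun X) g) (tensor unit X))
    (hs : Same (Tm.comp (tensor (N ⟨k + 1, hk⟩) X)
        (Tm.tens (Tm.succN (k + 1) hk) (Tm.ident X)) f)
      (Tm.comp (tensor (tensor (N ⟨k + 1, hk⟩) X) (tensor (N ⟨k + 1, hk⟩) X))
        (Tm.delta hn (tensor (N ⟨k + 1, hk⟩) X))
        (Tm.comp (tensor (tensor (N ⟨k + 1, hk⟩) X) Y)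
          (Tm.tens (Tm.ident (tensor (N ⟨k + 1, hk⟩) X)) f) h))
      (tensor (N ⟨k + 1, hk⟩) X)) :
    Same f (Tm.sdr k g h) (tensor (N ⟨k + 1, hk⟩) X) := by
  rintro i _ ⟨a, x, rfl, ha, hx⟩
  have hz' := hz i (pair star x) ⟨_, _, rfl, rfl, hx⟩
  rcases mem_N_cases ha with ⟨hi, m, rfl⟩ | ⟨hi, rfl⟩
  · have hi' : i.1 ≤ k + 1 := hi
    clear ha
    induction m with
    | zero => simpa [ev, ev_zeroN, hi'] using hz'
    | succ m ih =>
      have hv : Mem (tensor (N ⟨k + 1, hk⟩) X) i (pair (nat m) x) :=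
        ⟨_, _, rfl, mem_N_nat hi m, hx⟩
      have hs' := hs i _ hv
      have hd := ev_delta hn _ i _ hv
      simp only [ev, hd, ev_succN, hi', if_true, fst_pair, snd_pair, toNat_nat, ih] at hs'
      exact hs'
  · have hi' : k + 1 < i.1 := hi
    simpa [ev, ev_zeroN, hi'.not_ge] using hz'

end SDR

/-! ### Soundness -/

/-- The two sides of a derivable equality are good and have the same interpretation. -/
structure Sound (f g : Tm n) (X Y : FR n) : Prop where
  left : Good f X Y
  right : Good g X Y
  same : Same f g X

theorem Good.sound {f g : Tm n} {X Y : FR n} (hf : Good f X Y) (he : Eqv f g X Y)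
    (hs : Same f g X) : Sound f g X Y := ⟨hf, hf.congr he hs, hs⟩

theorem Same.refl (f : Tm n) (X : FR n) : Same f f X := fun _ _ _ => rfl

theorem Sound.comp {f f' g g' : Tm n} {X Y Z : FR n} (hf : Sound f f' X Y)
    (hg : Sound g g' Y Z) : Sound (Tm.comp Y f g) (Tm.comp Y f' g') X Z where
  left := hf.left.comp hg.left
  right := hf.right.comp hg.right
  same i v hv := by
    simp only [ev]
    rw [← hf.same i v hv, hg.same i _ (hf.left.mem i v hv)]

theorem Sound.tens {f f' g g' : Tm n} {X Y Z W : FR n} (hf : Sound f f' X Y)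
    (hg : Sound g g' Z W) : Sound (Tm.tens f g) (Tm.tens f' g') (tensor X Z) (tensor Y W) where
  left := hf.left.tens hg.left
  right := hf.right.tens hg.right
  same := by
    rintro i _ ⟨a, b, rfl, ha, hb⟩
    simp only [ev, fst_pair, snd_pair]
    rw [hf.same i a ha, hg.same i b hb]

theorem Sound.trivial {k : ℕ} {hk : k + 1 < n} {Y : FR n} {a b : Tm n}
    (ha : Sound a a (low k hk Y) unit)
    (he : Sound (Tm.comp unit a b) (Tm.ident (low k hk Y)) (low k hk Y) (low k hk Y))
    (i : Fin n) (hi : k < i.1) : Trivial Y i := trivial_of_low ha.left he.same i hi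

/-- Typing is the diagonal of derivable equality, so one induction gives both goodness of all
morphisms and soundness of all equations. Goodness of both sides belongs to the claim because of
symmetry. In the recursion cases the required triangles are rebuilt as derivations from the same
premises. -/
theorem Eqv.sound {f g : Tm n} {X Y : FR n} (h : Eqv f g X Y) : Sound f g X Y := by
  induction h with
  | symm _ ih => exact ⟨ih.right, ih.left, fun i v hv => (ih.same i v hv).symm⟩
  | trans _ _ ih ih' =>
    exact ⟨ih.left, ih'.right, fun i v hv => (ih.same i v hv).trans (ih'.same i v hv)⟩
  | ident X => exact (Good.ident X).sound (Eqv.ident X) (Same.refl _ _)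
  | comp _ _ ih ih' => exact ih.comp ih'
  | id_comp h ih =>
    exact ((Good.ident _).comp ih.left).sound (Eqv.id_comp h) fun _ _ _ => rfl
  | comp_id h ih =>
    exact (ih.left.comp (Good.ident _)).sound (Eqv.comp_id h) fun _ _ _ => rfl
  | assoc h h' h'' ih ih' ih'' =>
    exact ((ih.left.comp ih'.left).comp ih''.left).sound (Eqv.assoc h h' h'') fun _ _ _ => rfl
  | tens _ _ ih ih' => exact ih.tens ih'
  | tens_id X Y =>
    refine ((Good.ident X).tens (Good.ident Y)).sound (Eqv.tens_id X Y) ?_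
    rintro i _ ⟨a, b, rfl, ha, hb⟩
    rfl
  | tens_comp h1 h2 h3 h4 i1 i2 i3 i4 =>
    exact ((i1.left.comp i2.left).tens (i3.left.comp i4.left)).sound
      (Eqv.tens_comp h1 h2 h3 h4) fun _ _ _ => rfl
  | lun X => exact (Good.lun X).sound (Eqv.lun X) (Same.refl _ _)
  | lunInv X => exact (Good.lunInv X).sound (Eqv.lunInv X) (Same.refl _ _)
  | lun_lunInv X =>
    refine ((Good.lun X).comp (Good.lunInv X)).sound (Eqv.lun_lunInv X) ?_
    rintro i _ ⟨a, b, rfl, rfl, hb⟩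
    rfl
  | lunInv_lun X =>
    exact ((Good.lunInv X).comp (Good.lun X)).sound (Eqv.lunInv_lun X) fun _ _ _ => rfl
  | asc X Y Z => exact (Good.asc X Y Z).sound (Eqv.asc X Y Z) (Same.refl _ _)
  | ascInv X Y Z => exact (Good.ascInv X Y Z).sound (Eqv.ascInv X Y Z) (Same.refl _ _)
  | asc_ascInv X Y Z =>
    refine ((Good.asc X Y Z).comp (Good.ascInv X Y Z)).sound (Eqv.asc_ascInv X Y Z) ?_
    rintro i _ ⟨_, c, rfl, ⟨a, b, rfl, ha, hb⟩, hc⟩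
    rfl
  | ascInv_asc X Y Z =>
    refine ((Good.ascInv X Y Z).comp (Good.asc X Y Z)).sound (Eqv.ascInv_asc X Y Z) ?_
    rintro i _ ⟨a, _, rfl, ha, b, c, rfl, hb, hc⟩
    rfl
  | sym X Y => exact (Good.sym X Y).sound (Eqv.sym X Y) (Same.refl _ _)
  | sym_sym X Y =>
    refine ((Good.sym X Y).comp (Good.sym Y X)).sound (Eqv.sym_sym X Y) ?_
    rintro i _ ⟨a, b, rfl, ha, hb⟩
    rfl
  | lun_nat h ih =>
    exact (((Good.ident _).tens ih.left).comp (Good.lun _)).sound (Eqv.lun_nat h)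
      fun _ _ _ => rfl
  | asc_nat h1 h2 h3 i1 i2 i3 =>
    exact (((i1.left.tens i2.left).tens i3.left).comp (Good.asc _ _ _)).sound
      (Eqv.asc_nat h1 h2 h3) fun _ _ _ => rfl
  | sym_nat h1 h2 i1 i2 =>
    exact ((i1.left.tens i2.left).comp (Good.sym _ _)).sound (Eqv.sym_nat h1 h2)
      fun _ _ _ => rfl
  | pentagon W X Y Z =>
    exact (((Good.asc W X Y).tens (Good.ident Z)).comp ((Good.asc W (tensor X Y) Z).comp
      ((Good.ident W).tens (Good.asc X Y Z)))).sound (Eqv.pentagon W X Y Z) fun _ _ _ => rfl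
  | triangle X Y =>
    exact ((Good.asc X unit Y).comp ((Good.ident X).tens (Good.lun Y))).sound
      (Eqv.triangle X Y) fun _ _ _ => rfl
  | hexagon X Y Z =>
    exact ((Good.asc X Y Z).comp ((Good.sym X (tensor Y Z)).comp (Good.asc Y Z X))).sound
      (Eqv.hexagon X Y Z) fun _ _ _ => rfl
  | act φ _ ih =>
    exact ⟨ih.left.act φ, ih.right.act φ, fun i v hv => ih.same _ v ((mem_act φ _ i v).1 hv)⟩
  | act_ident φ X =>
    exact ((Good.ident X).act φ).sound (Eqv.act_ident φ X) fun _ _ _ => rfl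
  | act_comp φ h1 h2 i1 i2 =>
    exact ((i1.left.comp i2.left).act φ).sound (Eqv.act_comp φ h1 h2) fun _ _ _ => rfl
  | act_tens φ h1 h2 i1 i2 =>
    exact ((i1.left.tens i2.left).act φ).sound (Eqv.act_tens φ h1 h2) fun _ _ _ => rfl
  | act_lun φ X => exact ((Good.lun X).act φ).sound (Eqv.act_lun φ X) fun _ _ _ => rfl
  | act_asc φ X Y Z =>
    exact ((Good.asc X Y Z).act φ).sound (Eqv.act_asc φ X Y Z) fun _ _ _ => rfl
  | act_sym φ X Y => exact ((Good.sym X Y).act φ).sound (Eqv.act_sym φ X Y) fun _ _ _ => rfl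
  | act_id h ih =>
    exact (ih.left.congr (Eqv.act_id h).symm fun _ _ _ => rfl).sound (Eqv.act_id h)
      fun _ _ _ => rfl
  | act_act φ ψ h ih =>
    exact ((ih.left.act φ).act ψ).sound (Eqv.act_act φ ψ h) fun _ _ _ => rfl
  | cell hle X => exact (Good.cell hle X).sound (Eqv.cell hle X) (Same.refl _ _)
  | @cell_nat φ ψ hle f X Y h ih =>
    refine ((ih.left.act φ).comp (Good.cell hle Y)).sound (Eqv.cell_nat hle h) ?_
    intro i v hv
    -- Naturality of the interpretation along `φ i ≤ ψ i`; this rule is the reason why goodness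
    -- includes it.
    exact ih.left.natural _ _ v (hle i) ((mem_act φ X i v).1 hv)
  | cell_refl φ X =>
    refine (Good.cell le_rfl X).sound (Eqv.cell_refl φ X) ?_
    intro i v hv
    exact tr_self ((mem_act φ X i v).1 hv)
  | cell_trans h1 h2 X =>
    exact ((Good.cell h1 X).comp (Good.cell h2 X)).sound (Eqv.cell_trans h1 h2 X)
      fun i v _ => tr_tr X (h2 i) v
  | act_cell θ hle X =>
    exact ((Good.cell hle X).act θ).sound (Eqv.act_cell θ hle X) fun _ _ _ => rfl
  | cell_act θ hle X =>
    exact (Good.cell hle (X.act θ)).sound (Eqv.cell_act θ hle X) fun i v _ => tr_act θ X _ v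
  | cell_unit hle =>
    refine (Good.cell hle unit).sound (Eqv.cell_unit hle) ?_
    rintro i _ rfl
    rfl
  | cell_tensor hle X Y =>
    exact (Good.cell hle (tensor X Y)).sound (Eqv.cell_tensor hle X Y) fun _ _ _ => rfl
  | zero h => exact (Good.zero h).sound (Eqv.zero h) (Same.refl _ _)
  | succ h => exact (Good.succ h).sound (Eqv.succ h) (Same.refl _ _)
  | T_zero h =>
    have g := (Good.zero (by omega)).act (T 0 h)
    rw [act_T_N_zero h] at g
    refine g.sound (Eqv.T_zero h) ?_
    rintro i _ rfl
    -- `T 0` omits stage `0`, the only one at which `N 0` is not a point.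
    have hT : (T 0 h i).1 ≠ 0 := by
      rw [T_val]
      split_ifs <;> omega
    simp [ev, hT]
  | T_succ h =>
    have g := (Good.succ (by omega)).act (T 0 h)
    rw [act_T_N_zero h] at g
    refine g.sound (Eqv.T_succ h) ?_
    rintro i _ rfl
    have hT : (T 0 h i).1 ≠ 0 := by
      rw [T_val]
      split_ifs <;> omega
    simp [ev, hT]
  | flat h0 pX pY hg hh ig ih =>
    exact (Good.flat pY ig.left ih.left (Eqv.flat h0 pX pY hg.left hh.left)
      (Eqv.flat_zero h0 pX pY hg.left hh.left) (Eqv.flat_succ h0 pX pY hg.left hh.left)).sound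
      (Eqv.flat h0 pX pY hg hh) (Same.flat ig.same ih.same)
  | flat_zero h0 pX pY hg hh ig ih =>
    have gf := Good.flat pY ig.left ih.left (Eqv.flat h0 pX pY hg hh)
      (Eqv.flat_zero h0 pX pY hg hh) (Eqv.flat_succ h0 pX pY hg hh)
    refine (((Good.zero h0).tens (Good.ident _)).comp gf).sound (Eqv.flat_zero h0 pX pY hg hh) ?_
    rintro i _ ⟨a, x, rfl, -, hx⟩
    simp only [ev, fst_pair, snd_pair]
    split_ifs <;> rfl
  | flat_succ h0 pX pY hg hh ig ih =>
    have gf := Good.flat pY ig.left ih.left (Eqv.flat h0 pX pY hg hh)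
      (Eqv.flat_zero h0 pX pY hg hh) (Eqv.flat_succ h0 pX pY hg hh)
    exact (((Good.succ h0).tens (Good.ident _)).comp gf).sound (Eqv.flat_succ h0 pX pY hg hh)
      (same_flat_succ pY ig.left ih.left)
  | flat_uniq h0 pX pY hg hh hf hz hs ig ih jf jz js =>
    -- Goodness of the recursor is inherited from the competitor, to which it is derivably equal.
    exact jf.left.sound (Eqv.flat_uniq h0 pX pY hg hh hf hz hs) (same_flat_uniq jz.same js.same)
  | srr hk h1 h2 h3 h4 hg hh i1 i2 i3 i4 ig ih =>
    exact (Good.srr (i1.trivial i3) ig.left ih.left (Eqv.srr hk h1 h2 h3 h4 hg.left hh.left)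
      (Eqv.srr_zero hk h1 h2 h3 h4 hg.left hh.left)
      (Eqv.srr_succ hk h1 h2 h3 h4 hg.left hh.left)).sound
      (Eqv.srr hk h1 h2 h3 h4 hg hh) (Same.srr ig.left ih.left ig.same ih.same)
  | srr_zero hk h1 h2 h3 h4 hg hh i1 i2 i3 i4 ig ih =>
    have gf := Good.srr (i1.trivial i3) ig.left ih.left (Eqv.srr hk h1 h2 h3 h4 hg hh)
      (Eqv.srr_zero hk h1 h2 h3 h4 hg hh) (Eqv.srr_succ hk h1 h2 h3 h4 hg hh)
    exact (((Good.zeroN _ hk).tens (Good.ident _)).comp gf).sound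
      (Eqv.srr_zero hk h1 h2 h3 h4 hg hh) same_srr_zero
  | srr_succ hk h1 h2 h3 h4 hg hh i1 i2 i3 i4 ig ih =>
    have gf := Good.srr (i1.trivial i3) ig.left ih.left (Eqv.srr hk h1 h2 h3 h4 hg hh)
      (Eqv.srr_zero hk h1 h2 h3 h4 hg hh) (Eqv.srr_succ hk h1 h2 h3 h4 hg hh)
    exact (((Good.succN _ hk).tens (Good.ident _)).comp gf).sound
      (Eqv.srr_succ hk h1 h2 h3 h4 hg hh) (same_srr_succ (i1.trivial i3) ig.left ih.left)
  | srr_uniq hk h1 h2 h3 h4 hg hh hf hz hs i1 i2 i3 i4 ig ih jf jz js =>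
    exact jf.left.sound (Eqv.srr_uniq hk h1 h2 h3 h4 hg hh hf hz hs)
      (same_srr_uniq jz.same js.same)
  | sdr hn hk h1 h2 h3 h4 hg hh i1 i2 i3 i4 ig ih =>
    exact (Good.sdr hn (i1.trivial i3) ig.left ih.left
      (Eqv.sdr hn hk h1 h2 h3 h4 hg.left hh.left)
      (Eqv.sdr_zero hn hk h1 h2 h3 h4 hg.left hh.left)
      (Eqv.sdr_succ hn hk h1 h2 h3 h4 hg.left hh.left)).sound
      (Eqv.sdr hn hk h1 h2 h3 h4 hg hh) (Same.sdr ig.left ih.left ig.same ih.same)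
  | sdr_zero hn hk h1 h2 h3 h4 hg hh i1 i2 i3 i4 ig ih =>
    have gf := Good.sdr hn (i1.trivial i3) ig.left ih.left (Eqv.sdr hn hk h1 h2 h3 h4 hg hh)
      (Eqv.sdr_zero hn hk h1 h2 h3 h4 hg hh) (Eqv.sdr_succ hn hk h1 h2 h3 h4 hg hh)
    exact (((Good.zeroN _ hk).tens (Good.ident _)).comp gf).sound
      (Eqv.sdr_zero hn hk h1 h2 h3 h4 hg hh) same_sdr_zero
  | sdr_succ hn hk h1 h2 h3 h4 hg hh i1 i2 i3 i4 ig ih =>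
    have gf := Good.sdr hn (i1.trivial i3) ig.left ih.left (Eqv.sdr hn hk h1 h2 h3 h4 hg hh)
      (Eqv.sdr_zero hn hk h1 h2 h3 h4 hg hh) (Eqv.sdr_succ hn hk h1 h2 h3 h4 hg hh)
    exact (((Good.succN _ hk).tens (Good.ident _)).comp gf).sound
      (Eqv.sdr_succ hn hk h1 h2 h3 h4 hg hh) (same_sdr_succ hn (i1.trivial i3) ig.left ih.left)
  | sdr_uniq hn hk h1 h2 h3 h4 hg hh hf hz hs i1 i2 i3 i4 ig ih jf jz js =>
    exact jf.left.sound (Eqv.sdr_uniq hn hk h1 h2 h3 h4 hg hh hf hz hs)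
      (same_sdr_uniq hn jz.same js.same)

/-! ### Global elements of the levels -/

theorem std_eq_mk (k : Fin n) (m : ℕ) : std k m = mk (stdTm k m) (Eqv.stdTm k m) := by
  induction m with
  | zero => rfl
  | succ m ih =>
    rw [std, ih]
    rfl

theorem ev_stdTm (k : Fin n) (m : ℕ) : ev (stdTm k m) ⟨0, k.pos⟩ star = nat m := by
  induction m with
  | zero => simp [stdTm, ev_zeroN]
  | succ m ih => simp [stdTm, ev, ih, ev_succN]

theorem act_orderHom_id (X : FR n) : X.act OrderHom.id = X := by
  induction X with
  | unit => rfl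
  | N j => exact actN_eq_N le_rfl fun _ hi => hi
  | tensor X Y hX hY => simp only [FR.act, hX, hY]

/-- A global element is determined by its restriction along the constant map at `0`. -/
theorem Eqv.of_act_cst_zero (h0 : 0 < n) {f g : Tm n} {X : FR n} (hf : Eqv f f unit X)
    (hg : Eqv g g unit X)
    (h : Eqv (Tm.act (cst ⟨0, h0⟩) f) (Tm.act (cst ⟨0, h0⟩) g) unit (X.act (cst ⟨0, h0⟩))) :
    Eqv f g unit X := by
  have hle : cst ⟨0, h0⟩ ≤ OrderHom.id := fun i => Nat.zero_le i.1
  have hX := act_orderHom_id X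
  -- Naturality of `cst 0 ≤ id` at `e`: the component at the unit is the identity, so `e` is its own
  -- restriction followed by a fixed morphism.
  have key : ∀ {e : Tm n}, Eqv e e unit X →
      Eqv (Tm.comp (X.act (cst ⟨0, h0⟩)) (Tm.act (cst ⟨0, h0⟩) e)
        (Tm.cell (cst ⟨0, h0⟩) OrderHom.id X)) e unit X := fun he => by
    have h1 := Eqv.cell_nat hle he
    rw [hX] at h1
    exact h1.trans ((Eqv.comp (Eqv.cell_unit hle) (Eqv.act_id he)).trans (Eqv.id_comp he))
  have hc := Eqv.cell hle X
  rw [hX] at hc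
  exact (key hf).symm.trans ((Eqv.comp h hc).trans (key hg))

theorem std_injective (k : Fin n) : Function.Injective (std k) := by
  intro m m' h
  rw [std_eq_mk, std_eq_mk] at h
  have h' := (mk_exact h).sound.same ⟨0, k.pos⟩ star rfl
  rw [ev_stdTm, ev_stdTm] at h'
  exact Val.nat.inj h'

theorem std_surjective (k : Fin n) : Function.Surjective (std k) := by
  intro f
  induction f using Quotient.inductionOn with | _ f
  obtain ⟨f, hf⟩ := f
  -- The value `star` of the unit names the identity, so this says that `f` and the predicted
  -- numeral agree at stage `0`.
  have hr := hf.sound.left.real ⟨0, k.pos⟩ star rfl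
  refine ⟨(ev f ⟨0, k.pos⟩ star).toNat, ?_⟩
  rw [std_eq_mk]
  refine Quotient.sound (Eqv.of_act_cst_zero k.pos (Eqv.stdTm k _) hf ?_)
  exact hr.eqv.symm.trans (Eqv.act _ (Eqv.id_comp hf))

end FreeRec

theorem corollary25 (n : ℕ) (hn : 2 < n) (k : Fin n) :
    Function.Bijective (FreeRec.std k : ℕ → (FreeRec.Gam n).obj (FreeRec.FR.N k)) :=
  ⟨FreeRec.std_injective k, FreeRec.std_surjective k⟩
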